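/- Let $n \in \mathbb{N}$, $n \ge 1$, and let $\mathcal{C}^n_0$ be the set of compact convex sets $K \subset \mathbb{R}^n$ with $0$ in their interior, equipped with the Hausdorff metric. For $K \in \mathcal{C}^n_0$ let $h_K(a) = \sup\{a^T x : x \in K\}$ be its support function, $\|x\|_K = \inf\{\lambda \ge 0 : x \in \lambda K\}$ its gauge function, and $K^\circ = \{a : a^T x \le 1 \text{ for all } x \in K\}$ its polar. Let $\mathbb{B}_2$ and $\mathbb{S}_2$ be the Euclidean unit ball and unit sphere of $\mathbb{R}^n$. For $a,b>0$ put $m_p(a,b) = \left(\frac{a^p+b^p}{2}\right)^{1/p}$ if $p \in \mathbb{R}\setminus\{0\}$, and $m_0(a,b)=\sqrt{ab}$. For $K,L \in \mathcal{C}^n_0$ and $p \in \mathbb{R}$ the upper and lower $p$-means are $$\overline{M}_p(K,L) = \{x \in \mathbb{R}^n : a^T x \le m_p(h_K(a),h_L(a)) \text{ for all } a \in \mathbb{S}_2\},$$ $$\underline{M}_p(K,L) = \operatorname{conv}\{ m_{-p}(\|x\|_K,\|x\|_L)^{-1}\, x : x \in \mathbb{S}_2\}.$$ Define recursively $\overline{M}_p^{1}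 = \overline{M}_p(K,L)$, $\underline{M}_{-p}^{1} = \underline{M}_{-p}(K,L)$ and, for $i \ge 1$, $\overline{M}_p^{i+1} = \overline{M}_p(\overline{M}_p^{i},\underline{M}_{-p}^{i})$, $\underline{M}_{-p}^{i+1} = \underline{M}_{-p}(\overline{M}_p^{i},\underline{M}_{-p}^{i})$. **Theorem.** For all $p \in \mathbb{R}$ and $K,L \in \mathcal{C}^n_0$, the sequences $(\overline{M}_p^{i})_i$ and $(\underline{M}_{-p}^{i})_i$ converge in the Hausdorff metric to a common limit $G_p(K,L) \in \mathcal{C}^n_0$. Let $K,K',L,L' \in \mathcal{C}^n_0$ with $K \subset K'$ and $L \subset L'$, let $A,P \in \mathbb{R}^{n\times n}$ with $A$ regular and $P$ (symmetric) positive definite, and let $\alpha,\beta>0$. Then for all $p \in \mathbb{R}$: 1. (P1) $G_p(K,K)=K$. 2. (P2) $G_p(K,L)=G_p(L,K)$. 3. (P3) $G_p(K,L) \subset G_p(K',L')$. 4. (P4) $G_p : \mathcal{C}^n_0 \times \mathcal{C}^n_0 \to \mathcal{C}^n_0$ is continuous with respect to the Hausdorff metric. 5. (P5) $G_p(AK,AL)=A\,G_p(K,L)$.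 6. (P6) $G_p(PK,K^\circ)=P^{1/2}\,\mathbb{B}_2$, and in particular $G_p(K,K^\circ)=\mathbb{B}_2$. 7. (P7) $(G_p(K,L))^\circ = G_p(K^\circ,L^\circ)$. 8. (P8) $\underline{M}_0(K,L) \subset G_p(K,L) \subset \overline{M}_0(K,L)$. For $p=0$, moreover: - (P8*) $\underline{M}_0(K,L) = G_0(K,L)$ if and only if $n=1$ or $K$ and $L$ are dilatates of each other (that is, $K=cL$ for some $c>0$); likewise, $G_0(K,L)=\overline{M}_0(K,L)$ if and only if $n=1$ or $K$ and $L$ are dilatates of each other. - (P9) $G_0(\alpha K,\beta L)=\sqrt{\alpha\beta}\;G_0(K,L)$. -/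

import Mathlib

open Set Filter Topology
open scoped Pointwise MatrixOrder

noncomputable section

/-- `ℝⁿ` with the Euclidean norm and inner product. -/
abbrev Euc (n : ℕ) : Type := EuclideanSpace ℝ (Fin n)

/-- The convex bodies in `ℝⁿ` (non-empty compact convex sets) that contain the origin in their
interior. As a subtype of `ConvexBody`, this type carries the Hausdorff metric. -/
abbrev OriginBody (n : ℕ) : Type :=
  {K : ConvexBody (Euc n) // (0 : Euc n) ∈ interior (K : Set (Euc n))}

namespace OriginBody

/-- The underlying set of points of a body. -/
abbrev pts {n : ℕ} (K : OriginBody n) : Set (Euc n) := (K.1 : Set (Euc n))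

end OriginBody

/-- The `p`-mean of two positive real numbers, for real `p`. -/
def pMean (p a b : ℝ) : ℝ :=
  if p = 0 then √(a * b) else ((a ^ p + b ^ p) / 2) ^ (1 / p)

/-- The support function `h_C(a) = sup {aᵀx : x ∈ C}`. -/
def supportFun {n : ℕ} (C : Set (Euc n)) (a : Euc n) : ℝ :=
  sSup ((fun x => inner ℝ a x) '' C)

/-- The polar `C° = {a : aᵀx ≤ 1 for all x ∈ C}`. -/
def polarSet {n : ℕ} (C : Set (Euc n)) : Set (Euc n) :=
  {a | ∀ x ∈ C, inner ℝ a x ≤ 1}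

/-- The upper `p`-mean: all `x` with `aᵀx ≤ m_p(h_K(a), h_L(a))` for all unit vectors `a`. -/
def upperMeanSet {n : ℕ} (p : ℝ) (K L : Set (Euc n)) : Set (Euc n) :=
  {x | ∀ a ∈ Metric.sphere (0 : Euc n) 1,
    inner ℝ a x ≤ pMean p (supportFun K a) (supportFun L a)}

/-- The lower `p`-mean: the convex hull of all `(m_{-p}(‖x‖_K, ‖x‖_L))⁻¹ x`, `x` a unit vector,
where `‖x‖_K = inf {r > 0 : x ∈ r K}` is the gauge function. -/
def lowerMeanSet {n : ℕ} (p : ℝ) (K L : Set (Euc n)) : Set (Euc n) :=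
  convexHull ℝ ((fun x => (pMean (-p) (gauge K x) (gauge L x))⁻¹ • x) ''
    Metric.sphere (0 : Euc n) 1)

section Means

theorem pMean_swap (p a b : ℝ) : pMean p a b = pMean p b a := by
  unfold pMean
  rw [mul_comm, add_comm]

theorem pMean_bounds_aux (p : ℝ) {a b : ℝ} (ha : 0 < a) (hab : a ≤ b) :
    a ≤ pMean p a b ∧ pMean p a b ≤ b := by
  have hb : 0 < b := ha.trans_le hab
  unfold pMean
  split_ifs with hp
  · constructor
    · apply Real.le_sqrt_of_sq_le
      nlinarith
    · rw [Real.sqrt_le_left hb.le]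
      nlinarith
  · have hap := Real.rpow_pos_of_pos ha p
    have hbp := Real.rpow_pos_of_pos hb p
    have e1 : (a ^ p) ^ (1 / p) = a := by
      rw [← Real.rpow_mul ha.le, mul_one_div_cancel hp, Real.rpow_one]
    have e2 : (b ^ p) ^ (1 / p) = b := by
      rw [← Real.rpow_mul hb.le, mul_one_div_cancel hp, Real.rpow_one]
    rcases lt_or_gt_of_ne hp with h | h
    · have hle : b ^ p ≤ a ^ p := Real.rpow_le_rpow_of_nonpos ha hab h.le
      have hq : 1 / p ≤ 0 := (one_div_neg.2 h).le
      constructor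
      · calc a = (a ^ p) ^ (1 / p) := e1.symm
          _ ≤ _ := Real.rpow_le_rpow_of_nonpos (by positivity) (by linarith) hq
      · calc _ ≤ (b ^ p) ^ (1 / p) :=
              Real.rpow_le_rpow_of_nonpos hbp (by linarith) hq
          _ = b := e2
    · have hle : a ^ p ≤ b ^ p := Real.rpow_le_rpow ha.le hab h.le
      have hq : 0 ≤ 1 / p := (one_div_pos.2 h).le
      constructor
      · calc a = (a ^ p) ^ (1 / p) := e1.symm
          _ ≤ _ := Real.rpow_le_rpow hap.le (by linarith) hq
      · calc _ ≤ (b ^ p) ^ (1 / p) :=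
              Real.rpow_le_rpow (by positivity) (by linarith) hq
          _ = b := e2

theorem min_le_pMean (p : ℝ) {a b : ℝ} (ha : 0 < a) (hb : 0 < b) : min a b ≤ pMean p a b := by
  rcases le_total a b with h | h
  · rw [min_eq_left h]; exact (pMean_bounds_aux p ha h).1
  · rw [min_eq_right h, pMean_swap]; exact (pMean_bounds_aux p hb h).1

theorem pMean_le_max (p : ℝ) {a b : ℝ} (ha : 0 < a) (hb : 0 < b) : pMean p a b ≤ max a b := by
  rcases le_total a b with h | h
  · rw [max_eq_right h]; exact (pMean_bounds_aux p ha h).2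
  · rw [max_eq_left h, pMean_swap]; exact (pMean_bounds_aux p hb h).2

theorem pMean_pos (p : ℝ) {a b : ℝ} (ha : 0 < a) (hb : 0 < b) : 0 < pMean p a b :=
  (lt_min ha hb).trans_le (min_le_pMean p ha hb)

theorem continuousOn_pMean {X : Type*} [TopologicalSpace X] {s : Set X} (p : ℝ) {f g : X → ℝ}
    (hf : ContinuousOn f s) (hg : ContinuousOn g s) (hf0 : ∀ x ∈ s, 0 < f x)
    (hg0 : ∀ x ∈ s, 0 < g x) : ContinuousOn (fun x => pMean p (f x) (g x)) s := by
  unfold pMean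
  split_ifs with hp
  · exact Real.continuous_sqrt.comp_continuousOn (hf.mul hg)
  · refine ContinuousOn.rpow_const (ContinuousOn.div_const (ContinuousOn.add
      (hf.rpow_const fun x hx => Or.inl (hf0 x hx).ne')
      (hg.rpow_const fun x hx => Or.inl (hg0 x hx).ne')) 2) ?_
    intro x hx
    have h1 := Real.rpow_pos_of_pos (hf0 x hx) p
    have h2 := Real.rpow_pos_of_pos (hg0 x hx) p
    left
    positivity

end Means

/-- In `ℝⁿ` the convex hull of a compact set is compact. -/
theorem isCompact_convexHull_euc {n : ℕ} {s : Set (Euc n)} (hs : IsCompact s) :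
    IsCompact (convexHull ℝ s) := by
  classical
  have key : convexHull ℝ s = (fun q : (Fin (n + 1) → ℝ) × (Fin (n + 1) → Euc n) =>
      ∑ i, q.1 i • q.2 i) '' (stdSimplex ℝ (Fin (n + 1)) ×ˢ Set.pi univ fun _ => s) := by
    apply Subset.antisymm
    · intro x hx
      obtain ⟨ι, _, z, w, hz, hai, hw, hw1, hx'⟩ := eq_pos_convex_span_of_mem_convexHull hx
      have hcard : Fintype.card ι ≤ Fintype.card (Fin (n + 1)) := by
        have h1 := hai.card_le_finrank_succ
        have h2 : Module.finrank ℝ (vectorSpan ℝ (Set.range z)) ≤ n := by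
          simpa using Submodule.finrank_le (vectorSpan ℝ (Set.range z))
        simp only [Fintype.card_fin]
        omega
      obtain ⟨f⟩ := Function.Embedding.nonempty_of_card_le hcard
      obtain ⟨y0, hy0⟩ : s.Nonempty := convexHull_nonempty_iff.1 ⟨x, hx⟩
      have hsum : ∀ {M : Type} [AddCommMonoid M] (F : Fin (n + 1) → M) (G : ι → M),
          (∀ i, F (f i) = G i) → (∀ j, (¬ ∃ i, f i = j) → F j = 0) → ∑ j, F j = ∑ i, G i := by
        intro M _ F G h1 h2
        symm
        refine Finset.sum_of_injOn f f.injective.injOn (by simp) ?_ (fun i _ => (h1 i).symm)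
        intro j _ hj
        apply h2
        rintro ⟨i, rfl⟩
        exact hj ⟨i, by simp, rfl⟩
      refine ⟨(Function.extend f w 0, Function.extend f z fun _ => y0), ⟨⟨?_, ?_⟩, ?_⟩, ?_⟩
      · intro j
        by_cases h : ∃ i, f i = j
        · obtain ⟨i, rfl⟩ := h
          simpa [f.injective.extend_apply] using (hw i).le
        · simp [Function.extend_apply' _ _ _ h]
      · rw [← hw1]
        exact hsum _ _ (fun i => f.injective.extend_apply _ _ _)
          (fun j h => by simp [Function.extend_apply' _ _ _ h])
      · intro j _
        by_cases h : ∃ i, f i = j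
        · obtain ⟨i, rfl⟩ := h
          simpa [f.injective.extend_apply] using hz ⟨i, rfl⟩
        · simpa [Function.extend_apply' _ _ _ h] using hy0
      · rw [← hx']
        exact hsum _ _ (fun i => by simp [f.injective.extend_apply])
          (fun j h => by simp [Function.extend_apply' _ _ _ h])
    · rintro _ ⟨⟨w, z⟩, ⟨hw, hz⟩, rfl⟩
      exact (convex_convexHull ℝ s).sum_mem (fun i _ => hw.1 i) hw.2
        fun i _ => subset_convexHull ℝ s (hz i (mem_univ i))
  rw [key]
  exact ((isCompact_stdSimplex ℝ _).prod (isCompact_univ_pi fun _ => hs)).image (by fun_prop)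

namespace OriginBody

variable {n : ℕ}

theorem pts_mem_nhds (K : OriginBody n) : K.pts ∈ 𝓝 (0 : Euc n) :=
  mem_interior_iff_mem_nhds.1 K.2

theorem exists_ball_subset (K : OriginBody n) :
    ∃ r > 0, Metric.closedBall (0 : Euc n) r ⊆ K.pts :=
  Metric.nhds_basis_closedBall.mem_iff.1 K.pts_mem_nhds

theorem exists_subset_ball (K : OriginBody n) :
    ∃ R > 0, K.pts ⊆ Metric.closedBall (0 : Euc n) R := by
  obtain ⟨R, h0, hR⟩ := K.1.isBounded.exists_pos_norm_le
  exact ⟨R, h0, fun x hx => by simpa using hR x hx⟩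

theorem supportFun_bounds (K : OriginBody n) {r R : ℝ} (hr : 0 < r)
    (hrK : Metric.closedBall (0 : Euc n) r ⊆ K.pts)
    (hRK : K.pts ⊆ Metric.closedBall (0 : Euc n) R) {a : Euc n} (ha : ‖a‖ = 1) :
    r ≤ supportFun K.pts a ∧ supportFun K.pts a ≤ R := by
  have hle : ∀ x ∈ K.pts, inner ℝ a x ≤ R := by
    intro x hx
    have h1 := real_inner_le_norm a x
    have h2 : ‖x‖ ≤ R := by simpa using hRK hx
    rw [ha, one_mul] at h1
    exact h1.trans h2
  constructor
  · apply le_csSup ⟨R, by rintro _ ⟨x, hx, rfl⟩; exact hle x hx⟩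
    refine ⟨r • a, hrK ?_, ?_⟩
    · simp [norm_smul, ha, abs_of_pos hr]
    · simp [inner_smul_right, ha]
  · apply csSup_le (K.1.nonempty.image _)
    rintro _ ⟨x, hx, rfl⟩
    exact hle x hx

theorem gauge_pos_of_norm_eq_one (K : OriginBody n) {x : Euc n} (hx : ‖x‖ = 1) :
    0 < gauge K.pts x := by
  refine (gauge_pos (absorbent_nhds_zero K.pts_mem_nhds)
    (NormedSpace.isVonNBounded_of_isBounded ℝ K.1.isBounded)).2 ?_
  rintro rfl
  simp at hx

/-- The closed Euclidean unit ball. -/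
def unitBall (n : ℕ) : OriginBody n :=
  ⟨⟨Metric.closedBall 0 1, convex_closedBall 0 1, isCompact_closedBall 0 1,
    Metric.nonempty_closedBall.2 zero_le_one⟩,
    mem_interior_iff_mem_nhds.2 (Metric.closedBall_mem_nhds 0 one_pos)⟩

instance : Nonempty (OriginBody n) := ⟨unitBall n⟩

/-- The dilate `α K`, for `α > 0`. -/
def scale (α : ℝ) (hα : 0 < α) (K : OriginBody n) : OriginBody n :=
  ⟨α • K.1, by
    rw [ConvexBody.coe_smul, mem_interior_iff_mem_nhds]
    exact (set_smul_mem_nhds_zero_iff hα.ne').2 K.pts_mem_nhds⟩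

/-- The image `A K` of a body under a regular matrix `A`. -/
def linImage (A : Matrix (Fin n) (Fin n) ℝ) (hA : IsUnit A) (K : OriginBody n) : OriginBody n :=
  ⟨⟨Matrix.toEuclideanLin A '' K.pts, K.1.convex.linear_image _,
    K.1.isCompact.image (LinearMap.continuous_of_finiteDimensional _), K.1.nonempty.image _⟩, by
    have hsurj : Function.Surjective (Matrix.toEuclideanLin A) := by
      obtain ⟨B, hB⟩ := hA.exists_right_inv
      intro y
      refine ⟨Matrix.toEuclideanLin B y, ?_⟩
      simp [Matrix.toLpLin_apply, Matrix.mulVec_mulVec, hB]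
    have hopen : IsOpenMap (Matrix.toEuclideanLin A) :=
      (LinearMap.toContinuousLinearMap (Matrix.toEuclideanLin A)).isOpenMap hsurj
    have h := hopen.image_mem_nhds K.pts_mem_nhds
    rw [map_zero] at h
    exact mem_interior_iff_mem_nhds.2 h⟩

/-- The polar body `K°`. -/
def polar (K : OriginBody n) : OriginBody n :=
  ⟨⟨polarSet K.pts, by
      intro a ha b hb s t hs ht hst x hx
      have h1 := mul_le_mul_of_nonneg_left (ha x hx) hs
      have h2 := mul_le_mul_of_nonneg_left (hb x hx) ht
      rw [inner_add_left, real_inner_smul_left, real_inner_smul_left]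
      linarith, by
      obtain ⟨r, hr, hrK⟩ := K.exists_ball_subset
      refine (isCompact_closedBall (0 : Euc n) r⁻¹).of_isClosed_subset ?_ ?_
      · have : polarSet K.pts = ⋂ x ∈ K.pts, {a : Euc n | inner ℝ a x ≤ 1} := by
          ext a; simp [polarSet]
        rw [this]
        exact isClosed_biInter fun x _ => isClosed_le (by fun_prop) continuous_const
      · intro a ha
        rw [mem_closedBall_zero_iff]
        by_cases h0 : a = 0
        · rw [h0, norm_zero]; positivity
        have hn : 0 < ‖a‖ := norm_pos_iff.2 h0
        have h1 := ha ((r / ‖a‖) • a) (hrK (by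
          rw [mem_closedBall_zero_iff, norm_smul, Real.norm_of_nonneg (by positivity),
            div_mul_cancel₀ _ hn.ne']))
        rw [real_inner_smul_right, real_inner_self_eq_norm_sq] at h1
        rw [← one_div, le_div_iff₀ hr]
        calc ‖a‖ * r = r / ‖a‖ * ‖a‖ ^ 2 := by field_simp
          _ ≤ 1 := h1,
    ⟨0, fun x _ => by simp⟩⟩, by
    obtain ⟨R, hR, hRK⟩ := K.exists_subset_ball
    refine mem_interior_iff_mem_nhds.2
      (mem_of_superset (Metric.closedBall_mem_nhds 0 (inv_pos.2 hR)) ?_)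
    intro a ha x hx
    rw [mem_closedBall_zero_iff] at ha
    have hx' : ‖x‖ ≤ R := by simpa using hRK hx
    calc inner ℝ a x ≤ ‖a‖ * ‖x‖ := real_inner_le_norm a x
      _ ≤ R⁻¹ * R := by gcongr
      _ = 1 := inv_mul_cancel₀ hR.ne'⟩

/-- The upper `p`-mean of two bodies, as a body. -/
def upperMean (p : ℝ) (K L : OriginBody n) : OriginBody n :=
  ⟨⟨upperMeanSet p K.pts L.pts, by
      intro x hx y hy s t hs ht hst a ha
      have h1 := mul_le_mul_of_nonneg_left (hx a ha) hs
      have h2 := mul_le_mul_of_nonneg_left (hy a ha) ht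
      rw [inner_add_right, real_inner_smul_right, real_inner_smul_right]
      calc _ ≤ _ := add_le_add h1 h2
        _ = _ := by rw [← add_mul, hst, one_mul], by
      obtain ⟨r, hr, hrK⟩ := K.exists_ball_subset
      obtain ⟨R, hR, hRK⟩ := K.exists_subset_ball
      obtain ⟨r', hr', hrL⟩ := L.exists_ball_subset
      obtain ⟨R', hR', hRL⟩ := L.exists_subset_ball
      refine (isCompact_closedBall (0 : Euc n) (max R R')).of_isClosed_subset ?_ ?_
      · have : upperMeanSet p K.pts L.pts = ⋂ a ∈ Metric.sphere (0 : Euc n) 1,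
            {x : Euc n | inner ℝ a x ≤ pMean p (supportFun K.pts a) (supportFun L.pts a)} := by
          ext a; simp [upperMeanSet]
        rw [this]
        exact isClosed_biInter fun x _ => isClosed_le (by fun_prop) continuous_const
      · intro x hx
        rw [mem_closedBall_zero_iff]
        by_cases h0 : x = 0
        · rw [h0, norm_zero]; positivity
        have hn : 0 < ‖x‖ := norm_pos_iff.2 h0
        have ha : ‖(‖x‖⁻¹ • x)‖ = 1 := by
          rw [norm_smul, norm_inv, norm_norm, inv_mul_cancel₀ hn.ne']
        have h1 := hx (‖x‖⁻¹ • x) (mem_sphere_zero_iff_norm.2 ha)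
        rw [real_inner_smul_left, real_inner_self_eq_norm_sq] at h1
        obtain ⟨b1, b2⟩ := K.supportFun_bounds hr hrK hRK ha
        obtain ⟨c1, c2⟩ := L.supportFun_bounds hr' hrL hRL ha
        calc ‖x‖ = ‖x‖⁻¹ * ‖x‖ ^ 2 := by field_simp
          _ ≤ _ := h1
          _ ≤ _ := pMean_le_max p (hr.trans_le b1) (hr'.trans_le c1)
          _ ≤ _ := max_le_max b2 c2, by
      obtain ⟨r, hr, hrK⟩ := K.exists_ball_subset
      obtain ⟨R, hR, hRK⟩ := K.exists_subset_ball
      obtain ⟨r', hr', hrL⟩ := L.exists_ball_subset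
      obtain ⟨R', hR', hRL⟩ := L.exists_subset_ball
      refine ⟨0, fun a ha => ?_⟩
      have ha' := mem_sphere_zero_iff_norm.1 ha
      rw [inner_zero_right]
      exact (pMean_pos p (hr.trans_le (K.supportFun_bounds hr hrK hRK ha').1)
        (hr'.trans_le (L.supportFun_bounds hr' hrL hRL ha').1)).le⟩, by
    obtain ⟨r, hr, hrK⟩ := K.exists_ball_subset
    obtain ⟨R, hR, hRK⟩ := K.exists_subset_ball
    obtain ⟨r', hr', hrL⟩ := L.exists_ball_subset
    obtain ⟨R', hR', hRL⟩ := L.exists_subset_ball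
    refine mem_interior_iff_mem_nhds.2
      (mem_of_superset (Metric.closedBall_mem_nhds 0 (lt_min hr hr')) ?_)
    intro x hx a ha
    have ha' := mem_sphere_zero_iff_norm.1 ha
    rw [mem_closedBall_zero_iff] at hx
    have b1 := (K.supportFun_bounds hr hrK hRK ha').1
    have c1 := (L.supportFun_bounds hr' hrL hRL ha').1
    calc inner ℝ a x ≤ ‖a‖ * ‖x‖ := real_inner_le_norm a x
      _ = ‖x‖ := by rw [ha', one_mul]
      _ ≤ _ := hx
      _ ≤ _ := min_le_min b1 c1
      _ ≤ _ := min_le_pMean p (hr.trans_le b1) (hr'.trans_le c1)⟩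

theorem lowerMean_aux (p : ℝ) (K L : OriginBody n) :
    ContinuousOn (fun x => pMean p (gauge K.pts x) (gauge L.pts x))
      (Metric.sphere (0 : Euc n) 1) :=
  continuousOn_pMean p (continuous_gauge K.1.convex K.pts_mem_nhds).continuousOn
    (continuous_gauge L.1.convex L.pts_mem_nhds).continuousOn
    (fun _ hx => K.gauge_pos_of_norm_eq_one (mem_sphere_zero_iff_norm.1 hx))
    (fun _ hx => L.gauge_pos_of_norm_eq_one (mem_sphere_zero_iff_norm.1 hx))

theorem gaugeMean_pos (p : ℝ) (K L : OriginBody n) {x : Euc n} (hx : ‖x‖ = 1) :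
    0 < pMean p (gauge K.pts x) (gauge L.pts x) :=
  pMean_pos p (K.gauge_pos_of_norm_eq_one hx) (L.gauge_pos_of_norm_eq_one hx)

theorem zero_mem_lowerMeanSet [NeZero n] (p : ℝ) (K L : OriginBody n) :
    (0 : Euc n) ∈ lowerMeanSet p K.pts L.pts := by
  obtain ⟨x, hx⟩ : (Metric.sphere (0 : Euc n) 1).Nonempty :=
    NormedSpace.sphere_nonempty.2 zero_le_one
  have hx1 := mem_sphere_zero_iff_norm.1 hx
  have hx2 : ‖-x‖ = 1 := by rwa [norm_neg]
  set u := (pMean (-p) (gauge K.pts x) (gauge L.pts x))⁻¹ with hu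
  set v := (pMean (-p) (gauge K.pts (-x)) (gauge L.pts (-x)))⁻¹ with hv
  have hu0 : 0 < u := inv_pos.2 (gaugeMean_pos (-p) K L hx1)
  have hv0 : 0 < v := inv_pos.2 (gaugeMean_pos (-p) K L hx2)
  have h1 : u • x ∈ lowerMeanSet p K.pts L.pts := subset_convexHull ℝ _ ⟨x, hx, rfl⟩
  have h2 : v • (-x) ∈ lowerMeanSet p K.pts L.pts :=
    subset_convexHull ℝ _ ⟨-x, mem_sphere_zero_iff_norm.2 hx2, rfl⟩
  have h := convex_convexHull ℝ _ h1 h2 (a := v / (u + v)) (b := u / (u + v))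
    (by positivity) (by positivity) (by field_simp; ring)
  have e : (v / (u + v)) • (u • x) + (u / (u + v)) • (v • (-x)) = 0 := by
    rw [smul_smul, smul_smul, smul_neg, ← sub_eq_add_neg, ← sub_smul]
    rw [show v / (u + v) * u - u / (u + v) * v = 0 by ring, zero_smul]
  rwa [e] at h

/-- The lower `p`-mean of two bodies, as a body (`n ≥ 1`). -/
def lowerMean [NeZero n] (p : ℝ) (K L : OriginBody n) : OriginBody n :=
  ⟨⟨lowerMeanSet p K.pts L.pts, convex_convexHull ℝ _,
    isCompact_convexHull_euc ((isCompact_sphere (0 : Euc n) 1).image_of_continuousOn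
      (((lowerMean_aux (-p) K L).inv₀ fun _ hx =>
        (gaugeMean_pos (-p) K L (mem_sphere_zero_iff_norm.1 hx)).ne').smul continuousOn_id)),
    ⟨0, zero_mem_lowerMeanSet p K L⟩⟩, by
    obtain ⟨M, hM⟩ := (isCompact_sphere (0 : Euc n) 1).bddAbove_image (lowerMean_aux (-p) K L)
    have hM' : (0 : ℝ) < max M 1 := lt_max_of_lt_right one_pos
    refine mem_interior_iff_mem_nhds.2
      (mem_of_superset (Metric.closedBall_mem_nhds 0 (inv_pos.2 hM')) ?_)
    intro y hy
    rw [mem_closedBall_zero_iff] at hy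
    by_cases h0 : y = 0
    · rw [h0]; exact zero_mem_lowerMeanSet p K L
    have hn : 0 < ‖y‖ := norm_pos_iff.2 h0
    have ha : ‖(‖y‖⁻¹ • y)‖ = 1 := by
      rw [norm_smul, norm_inv, norm_norm, inv_mul_cancel₀ hn.ne']
    set a := ‖y‖⁻¹ • y with hadef
    have hmem : (pMean (-p) (gauge K.pts a) (gauge L.pts a))⁻¹ • a ∈
        lowerMeanSet p K.pts L.pts :=
      subset_convexHull ℝ _ ⟨a, mem_sphere_zero_iff_norm.2 ha, rfl⟩
    set m := pMean (-p) (gauge K.pts a) (gauge L.pts a) with hm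
    have hm0 : 0 < m := gaugeMean_pos (-p) K L ha
    have hmM : m ≤ max M 1 :=
      (hM ⟨a, mem_sphere_zero_iff_norm.2 ha, rfl⟩).trans (le_max_left _ _)
    have hym : ‖y‖ * m ≤ 1 := by
      calc ‖y‖ * m ≤ (max M 1)⁻¹ * max M 1 := by gcongr
        _ = 1 := inv_mul_cancel₀ hM'.ne'
    have h := (convex_convexHull ℝ _).smul_mem_of_zero_mem (zero_mem_lowerMeanSet p K L) hmem
      (t := ‖y‖ * m) ⟨by positivity, hym⟩
    have e : (‖y‖ * m) • m⁻¹ • a = y := by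
      rw [hadef, smul_smul, smul_smul]
      rw [show ‖y‖ * m * m⁻¹ * ‖y‖⁻¹ = 1 by field_simp, one_smul]
    rwa [e] at h⟩

/-- The iteration of upper `p`-means and lower `(-p)`-means. Entry `i` is the pair consisting of
the `(i+1)`-st upper and the `(i+1)`-st lower iterated mean. -/
def iterMean [NeZero n] (p : ℝ) (K L : OriginBody n) : ℕ → OriginBody n × OriginBody n
  | 0 => (upperMean p K L, lowerMean (-p) K L)
  | i + 1 =>
    (upperMean p (iterMean p K L i).1 (iterMean p K L i).2,
      lowerMean (-p) (iterMean p K L i).1 (iterMean p K L i).2)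

/-- The `p`-geometric mean `G_p(K, L)`: the limit of the iterated means in the Hausdorff metric. -/
def geomMean [NeZero n] (p : ℝ) (K L : OriginBody n) : OriginBody n :=
  limUnder atTop fun i => (iterMean p K L i).1

/-- `K` and `L` are dilatates of each other: `K = c L` for some `c > 0`. -/
def IsDilatate (K L : OriginBody n) : Prop :=
  ∃ c : ℝ, 0 < c ∧ K.pts = c • L.pts

end OriginBody

end

/-!
The argument rests on comparing bodies multiplicatively. `Within t K L` says `K ⊆ t L`, that is
`h_K ≤ t h_L`. Both means are monotone and homogeneous, hence preserve `Within t`, and polarity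
exchanges the upper and the lower mean (`polar_lowerMean`), so that facts about one of them
transfer to the other.

*Convergence.* If `K` and `L` are within the factor `t ≥ 1` of each other, then the upper `p`-mean
is contained in `m_p(1, t) K` and in `m_p(1, t) L`, hence in the `m_p(1, t)`-fold of any lower mean
of `K` and `L`; since the lower `(-p)`-mean lies in the upper `(-p)`-mean, the opposite inclusion
holds with the factor `m_{-p}(1, t)` (`within_step`). As `m_p(1, t) < t` for `t > 1`, the
comparison factors of the iterated pairs decrease to `1`, while each pair stays within the factors
reached by the earlier ones. The limit body is an intersection of dilates
(`exists_tendsto_of_within`), and convergence in the Hausdorff metric is equivalent to convergence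
of the comparison factors to `1`, because the origin is an interior point
(`tendsto_iff_within`).

*Invariance.* Monotonicity, continuity and homogeneity are all instances of the fact that the
geometric mean preserves `Within t`. It commutes with polarity since a step of the iteration does,
up to exchanging the two entries; thus `G_p(K, K°)` is self-polar, so it is the unit ball, and the
formula for `G_p(P K, K°)` follows by linear invariance. The inclusion in the upper `0`-mean holds
because `m_p(a, b) m_{-p}(a, b) = a b` makes the product of the two support functions
nonincreasing along the iteration.

*Equality.* If `G_0(K, L)` equals the upper `0`-mean, then the upper and the lower `0`-mean
coincide; call this body `G`. A contact functional `a` of `G` at a point `r` can be chosen among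
the generators of `G°`, where `h_K(a) h_L(a) = 1`, and the boundary point of `G` on the ray of `r`
is a convex combination of generators of `G`, where `‖y‖_K ‖y‖_L = 1`, in contact with `a`. This
forces equality in `⟪a, y⟫ ≤ h_K(a) ‖y‖_K` and in the same inequality for `L`
(`exists_common_contact`). Hence the gauges of `K` and `L` have proportional subgradients, with
equal logarithmic slopes along any segment avoiding the origin. For convex functions on an interval
this makes the ratio constant (`eq_of_common_log_slope`): its increments over a partition are
bounded by the mesh times the total increase of a monotone function. In dimension at least two any
two nonzero points are joined by such segments, so `K` and `L` are dilatates.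
-/

noncomputable section

/-! ### Means of two positive numbers -/

theorem pMean_nonneg (p : ℝ) {a b : ℝ} (ha : 0 ≤ a) (hb : 0 ≤ b) : 0 ≤ pMean p a b := by
  unfold pMean
  split_ifs <;> positivity

theorem pMean_mul (p : ℝ) {c a b : ℝ} (hc : 0 ≤ c) (ha : 0 ≤ a) (hb : 0 ≤ b) :
    pMean p (c * a) (c * b) = c * pMean p a b := by
  unfold pMean
  split_ifs with hp
  · rw [show c * a * (c * b) = c ^ 2 * (a * b) by ring, Real.sqrt_mul (sq_nonneg c),
      Real.sqrt_sq hc]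
  · rw [Real.mul_rpow hc ha, Real.mul_rpow hc hb, ← mul_add, mul_div_assoc,
      Real.mul_rpow (by positivity) (by positivity), ← Real.rpow_mul hc, mul_one_div_cancel hp,
      Real.rpow_one]

theorem pMean_mono (p : ℝ) {a b a' b' : ℝ} (ha : 0 < a) (hb : 0 < b) (haa : a ≤ a')
    (hbb : b ≤ b') : pMean p a b ≤ pMean p a' b' := by
  have ha' := ha.trans_le haa
  have hb' := hb.trans_le hbb
  unfold pMean
  split_ifs with hp
  · exact Real.sqrt_le_sqrt (mul_le_mul haa hbb hb.le ha'.le)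
  · rcases lt_or_gt_of_ne hp with h | h
    · have h1 := Real.rpow_le_rpow_of_nonpos ha haa h.le
      have h2 := Real.rpow_le_rpow_of_nonpos hb hbb h.le
      exact Real.rpow_le_rpow_of_nonpos (by positivity) (by linarith) (one_div_neg.2 h).le
    · have h1 := Real.rpow_le_rpow ha.le haa h.le
      have h2 := Real.rpow_le_rpow hb.le hbb h.le
      exact Real.rpow_le_rpow (by positivity) (by linarith) (one_div_pos.2 h).le

theorem pMean_neg (p : ℝ) {a b : ℝ} (ha : 0 ≤ a) (hb : 0 ≤ b) :
    pMean (-p) a b = (pMean p a⁻¹ b⁻¹)⁻¹ := by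
  unfold pMean
  simp only [neg_eq_zero]
  split_ifs with hp
  · rw [← mul_inv, Real.sqrt_inv, inv_inv]
  · rw [Real.rpow_neg ha, Real.rpow_neg hb, Real.inv_rpow ha, Real.inv_rpow hb, one_div, one_div,
      inv_neg, Real.rpow_neg (by positivity)]

theorem pMean_mul_pMean_neg (p : ℝ) {a b : ℝ} (ha : 0 < a) (hb : 0 < b) :
    pMean p a b * pMean (-p) a b = a * b := by
  rw [pMean_neg p ha.le hb.le]
  have h1 : pMean p a⁻¹ b⁻¹ = (a * b)⁻¹ * pMean p a b := by
    rw [pMean_swap p a b, ← pMean_mul p (by positivity) hb.le ha.le]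
    congr 1 <;> field_simp
  rw [h1]
  have := pMean_pos p ha hb
  field_simp

theorem pMean_self (p : ℝ) {a : ℝ} (ha : 0 < a) : pMean p a a = a :=
  le_antisymm (by simpa using pMean_le_max p ha ha) (by simpa using min_le_pMean p ha ha)

theorem pMean_one_lt (p : ℝ) {t : ℝ} (ht : 1 < t) : pMean p 1 t < t := by
  have h0 : 0 < t := one_pos.trans ht
  refine lt_of_le_of_ne (by simpa [ht.le] using pMean_le_max p one_pos h0) fun h => ?_
  unfold pMean at h
  split_ifs at h with hp
  · rw [Real.sqrt_eq_iff_mul_self_eq (by positivity) h0.le] at h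
    nlinarith
  · have h2 : (1 + t ^ p) / 2 = t ^ p := by
      have := congrArg (· ^ p) h
      simp only [Real.one_rpow] at this
      rwa [← Real.rpow_mul (by positivity), one_div_mul_cancel hp, Real.rpow_one] at this
    have h3 : t ^ p = 1 := by linarith
    rcases lt_or_gt_of_ne hp with h4 | h4
    · exact (Real.rpow_lt_one_of_one_lt_of_neg ht h4).ne h3
    · exact (Real.one_lt_rpow ht h4).ne' h3

namespace OriginBody

variable {n : ℕ}

/-! ### Support function, gauge and polarity -/

/-- The support function of a body. -/
abbrev supp (K : OriginBody n) (a : Euc n) : ℝ := supportFun K.pts a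

/-- The gauge function of a body. -/
abbrev gau (K : OriginBody n) (x : Euc n) : ℝ := gauge K.pts x

variable {K L : OriginBody n}

theorem inner_le_supp {x : Euc n} (hx : x ∈ K.pts) (a : Euc n) : inner ℝ a x ≤ K.supp a := by
  obtain ⟨R, hR⟩ := (K.1.isCompact.bddAbove_image (f := fun x => inner ℝ a x)
    (by fun_prop))
  exact le_csSup ⟨R, hR⟩ ⟨x, hx, rfl⟩

theorem supp_le {a : Euc n} {c : ℝ} (h : ∀ x ∈ K.pts, inner ℝ a x ≤ c) : K.supp a ≤ c := by
  apply csSup_le (K.1.nonempty.image _)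
  rintro _ ⟨x, hx, rfl⟩
  exact h x hx

theorem zero_mem (K : OriginBody n) : (0 : Euc n) ∈ K.pts := interior_subset K.2

theorem supp_nonneg (K : OriginBody n) (a : Euc n) : 0 ≤ K.supp a := by
  simpa using inner_le_supp K.zero_mem a

theorem supp_zero (K : OriginBody n) : K.supp 0 = 0 :=
  le_antisymm (supp_le fun _ _ => by simp) (K.supp_nonneg 0)

theorem supp_pos (K : OriginBody n) {a : Euc n} (ha : a ≠ 0) : 0 < K.supp a := by
  obtain ⟨r, hr, hrK⟩ := K.exists_ball_subset
  have hn : 0 < ‖a‖ := norm_pos_iff.2 ha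
  have h := inner_le_supp (K := K) (x := (r / ‖a‖) • a) (hrK (by
    rw [mem_closedBall_zero_iff, norm_smul, Real.norm_of_nonneg (by positivity),
      div_mul_cancel₀ _ hn.ne'])) a
  rw [real_inner_smul_right, real_inner_self_eq_norm_sq] at h
  exact lt_of_lt_of_le (by positivity) h

theorem supp_smul (K : OriginBody n) {c : ℝ} (hc : 0 ≤ c) (a : Euc n) :
    K.supp (c • a) = c * K.supp a := by
  rcases hc.eq_or_lt with rfl | hc
  · simp [supp_zero]
  have key : ∀ (d : ℝ) (_ : 0 < d) (b : Euc n), K.supp (d • b) ≤ d * K.supp b := by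
    intro d hd b
    refine supp_le fun x hx => ?_
    rw [real_inner_smul_left]
    exact mul_le_mul_of_nonneg_left (inner_le_supp hx b) hd.le
  refine le_antisymm (key c hc a) ?_
  have := key c⁻¹ (inv_pos.2 hc) (c • a)
  rw [smul_smul, inv_mul_cancel₀ hc.ne', one_smul] at this
  calc c * K.supp a ≤ c * (c⁻¹ * K.supp (c • a)) := by gcongr
    _ = _ := by field_simp

/-- A body is the intersection of its supporting half-spaces (Hahn–Banach). -/
theorem mem_iff_inner_le_supp {x : Euc n} : x ∈ K.pts ↔ ∀ a, inner ℝ a x ≤ K.supp a := by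
  refine ⟨fun hx a => inner_le_supp hx a, fun h => ?_⟩
  by_contra hx
  obtain ⟨f, u, h1, h2⟩ := geometric_hahn_banach_closed_point K.1.convex K.1.isClosed hx
  have hf : ∀ y, inner ℝ ((InnerProductSpace.toDual ℝ (Euc n)).symm f) y = f y :=
    fun y => InnerProductSpace.toDual_symm_apply
  have h3 := h ((InnerProductSpace.toDual ℝ (Euc n)).symm f)
  rw [hf] at h3
  have h4 : K.supp ((InnerProductSpace.toDual ℝ (Euc n)).symm f) ≤ u :=
    supp_le fun y hy => by rw [hf]; exact (h1 y hy).le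
  linarith

theorem ext_pts (h : K.pts = L.pts) : K = L := Subtype.ext (SetLike.coe_injective h)

theorem ext_supp (h : ∀ a, K.supp a = L.supp a) : K = L :=
  ext_pts (Set.ext fun x => by simp only [mem_iff_inner_le_supp, h])

theorem gau_le_one_iff {x : Euc n} : K.gau x ≤ 1 ↔ x ∈ K.pts := by
  rw [gauge_le_one_iff_mem_closure K.1.convex K.pts_mem_nhds, K.1.isClosed.closure_eq]

theorem gau_smul (K : OriginBody n) {c : ℝ} (hc : 0 ≤ c) (x : Euc n) :
    K.gau (c • x) = c * K.gau x := by
  simpa using gauge_smul_of_nonneg (s := K.pts) hc x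

theorem gau_pos (K : OriginBody n) {x : Euc n} (hx : x ≠ 0) : 0 < K.gau x :=
  (gauge_pos (absorbent_nhds_zero K.pts_mem_nhds)
    (NormedSpace.isVonNBounded_of_isBounded ℝ K.1.isBounded)).2 hx

theorem gau_inv_smul_mem (K : OriginBody n) {x : Euc n} (hx : x ≠ 0) :
    (K.gau x)⁻¹ • x ∈ K.pts := by
  have := K.gau_pos hx
  rw [← gau_le_one_iff, gau_smul K (by positivity), inv_mul_cancel₀ this.ne']

theorem inner_le_supp_mul_gau (K : OriginBody n) (a x : Euc n) :
    inner ℝ a x ≤ K.supp a * K.gau x := by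
  by_cases hx : x = 0
  · simp [hx]
  have h1 := K.gau_pos hx
  have := inner_le_supp (K.gau_inv_smul_mem hx) a
  rwa [real_inner_smul_right, inv_mul_le_iff₀ h1, mul_comm] at this

theorem mem_polar_iff {a : Euc n} : a ∈ K.polar.pts ↔ K.supp a ≤ 1 :=
  ⟨fun h => supp_le h, fun h _ hx => (inner_le_supp hx a).trans h⟩

theorem gau_polar (K : OriginBody n) (a : Euc n) : K.polar.gau a = K.supp a := by
  by_cases ha : a = 0
  · rw [ha, supp_zero]; exact gauge_zero
  have h1 := K.polar.gau_pos ha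
  have h2 := K.supp_pos ha
  apply le_antisymm
  · have : K.polar.gau ((K.supp a)⁻¹ • a) ≤ 1 := by
      rw [gau_le_one_iff, mem_polar_iff, supp_smul _ (by positivity), inv_mul_cancel₀ h2.ne']
    rwa [gau_smul _ (by positivity), inv_mul_le_iff₀ h2, mul_one] at this
  · have := K.polar.gau_inv_smul_mem ha
    rwa [mem_polar_iff, supp_smul _ (by positivity), inv_mul_le_iff₀ h1, mul_one] at this

/-- The bipolar theorem. -/
theorem polar_polar (K : OriginBody n) : K.polar.polar = K := by
  refine ext_pts (Set.ext fun x => ⟨fun h => ?_, fun hx a ha => ?_⟩)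
  · rw [mem_iff_inner_le_supp]
    intro a
    by_cases ha : a = 0
    · simp [ha, supp_zero]
    have h2 := K.supp_pos ha
    have h3 : (K.supp a)⁻¹ • a ∈ K.polar.pts := by
      rw [mem_polar_iff, supp_smul _ (by positivity), inv_mul_cancel₀ h2.ne']
    have h4 : inner ℝ x ((K.supp a)⁻¹ • a) ≤ 1 := h _ h3
    rwa [real_inner_smul_right, inv_mul_le_iff₀ h2, mul_one, real_inner_comm] at h4
  · rw [real_inner_comm]
    exact ha x hx

theorem supp_polar (K : OriginBody n) (x : Euc n) : K.polar.supp x = K.gau x := by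
  rw [← gau_polar, polar_polar]

theorem polar_injective : Function.Injective (polar (n := n)) := fun K L h => by
  rw [← K.polar_polar, h, L.polar_polar]

/-! ### Multiplicative comparison of bodies -/

/-- `K ⊆ t L`, expressed by the support functions. -/
def Within (t : ℝ) (K L : OriginBody n) : Prop := ∀ a, K.supp a ≤ t * L.supp a

theorem within_one_iff : Within 1 K L ↔ K.pts ⊆ L.pts := by
  refine ⟨fun h x hx => ?_, fun h a => ?_⟩
  · rw [mem_iff_inner_le_supp] at hx ⊢
    exact fun a => (hx a).trans (by simpa using h a)
  · rw [one_mul]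
    exact supp_le fun x hx => inner_le_supp (h hx) a

theorem Within.inv_smul_mem {t : ℝ} (h : Within t K L) (ht : 0 < t) {x : Euc n} (hx : x ∈ K.pts) :
    t⁻¹ • x ∈ L.pts := by
  rw [mem_iff_inner_le_supp]
  intro a
  rw [real_inner_smul_right, inv_mul_le_iff₀ ht]
  exact (inner_le_supp hx a).trans (h a)

theorem Within.gau_le {t : ℝ} (h : Within t K L) (ht : 0 < t) (x : Euc n) :
    L.gau x ≤ t * K.gau x := by
  by_cases hx : x = 0
  · simp [hx]
  have h1 := K.gau_pos hx
  have h2 := gau_le_one_iff.2 (h.inv_smul_mem ht (K.gau_inv_smul_mem hx))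
  rw [gau_smul _ (by positivity), gau_smul _ (by positivity)] at h2
  field_simp at h2
  linarith

theorem Within.polar {t : ℝ} (h : Within t K L) (ht : 0 < t) : Within t L.polar K.polar := by
  intro x
  rw [supp_polar, supp_polar]
  exact h.gau_le ht x

theorem Within.trans {s t : ℝ} {M : OriginBody n} (h : Within s K L) (h' : Within t L M)
    (hs : 0 ≤ s) : Within (s * t) K M := fun a =>
  (h a).trans (by rw [mul_assoc]; exact mul_le_mul_of_nonneg_left (h' a) hs)

theorem Within.mono {s t : ℝ} (h : Within s K L) (hst : s ≤ t) : Within t K L := fun a =>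
  (h a).trans (mul_le_mul_of_nonneg_right hst (L.supp_nonneg a))

theorem within_refl {t : ℝ} (ht : 1 ≤ t) (K : OriginBody n) : Within t K K := fun a =>
  le_mul_of_one_le_left (K.supp_nonneg a) ht

/-- Any two bodies are comparable up to some factor. -/
theorem exists_within (K L : OriginBody n) : ∃ t, 1 < t ∧ Within t K L := by
  obtain ⟨R, hR, hRK⟩ := K.exists_subset_ball
  obtain ⟨r, hr, hrL⟩ := L.exists_ball_subset
  refine ⟨R / r + 1, by linarith [div_pos hR hr], Within.mono (s := R / r) (fun a => ?_)
    (by linarith)⟩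
  by_cases ha : a = 0
  · simp [ha, supp_zero]
  have hn : 0 < ‖a‖ := norm_pos_iff.2 ha
  have h2 := inner_le_supp (K := L) (x := (r / ‖a‖) • a) (hrL (by
    rw [mem_closedBall_zero_iff, norm_smul, Real.norm_of_nonneg (by positivity),
      div_mul_cancel₀ _ hn.ne'])) a
  rw [real_inner_smul_right, real_inner_self_eq_norm_sq] at h2
  have h3 : K.supp a ≤ ‖a‖ * R := supp_le fun x hx => (real_inner_le_norm a x).trans
    (mul_le_mul_of_nonneg_left (by simpa using hRK hx) hn.le)
  calc K.supp a ≤ ‖a‖ * R := h3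
    _ = R / r * (r / ‖a‖ * ‖a‖ ^ 2) := by field_simp
    _ ≤ _ := by gcongr

/-! ### Upper and lower means -/

theorem mem_upperMean_iff {p : ℝ} {x : Euc n} :
    x ∈ (upperMean p K L).pts ↔ ∀ a, inner ℝ a x ≤ pMean p (K.supp a) (L.supp a) := by
  refine ⟨fun h a => ?_, fun h a _ => h a⟩
  by_cases ha : a = 0
  · rw [ha, inner_zero_left]
    exact pMean_nonneg p (K.supp_nonneg _) (L.supp_nonneg _)
  have hn : 0 < ‖a‖ := norm_pos_iff.2 ha
  have h1 : inner ℝ (‖a‖⁻¹ • a) x ≤ pMean p (K.supp (‖a‖⁻¹ • a)) (L.supp (‖a‖⁻¹ • a)) :=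
    h (‖a‖⁻¹ • a) (by rw [mem_sphere_zero_iff_norm, norm_smul, norm_inv, norm_norm,
      inv_mul_cancel₀ hn.ne'])
  rw [supp_smul _ (by positivity), supp_smul _ (by positivity),
    pMean_mul _ (by positivity) (K.supp_nonneg _) (L.supp_nonneg _), real_inner_smul_left] at h1
  exact le_of_mul_le_mul_left h1 (by positivity)

theorem supp_upperMean_le (p : ℝ) (K L : OriginBody n) (a : Euc n) :
    (upperMean p K L).supp a ≤ pMean p (K.supp a) (L.supp a) :=
  supp_le fun _ hx => mem_upperMean_iff.1 hx a

theorem upperMean_comm (p : ℝ) (K L : OriginBody n) : upperMean p K L = upperMean p L K :=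
  ext_pts (Set.ext fun x => by simp only [mem_upperMean_iff, pMean_swap p (K.supp _)])

theorem upperMean_self (p : ℝ) (K : OriginBody n) : upperMean p K K = K := by
  refine ext_pts (Set.ext fun x => ?_)
  rw [mem_upperMean_iff, mem_iff_inner_le_supp]
  refine forall_congr' fun a => ?_
  by_cases ha : a = 0
  · simp only [ha, inner_zero_left, supp_nonneg, iff_true]
    exact pMean_nonneg p (K.supp_nonneg _) (K.supp_nonneg _)
  · rw [pMean_self p (K.supp_pos ha)]

theorem within_upperMean {p t : ℝ} {K' L' : OriginBody n} (ht : 0 < t) (hK : Within t K K')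
    (hL : Within t L L') : Within t (upperMean p K L) (upperMean p K' L') := by
  intro a
  refine supp_le fun x hx => ?_
  have h1 : t⁻¹ • x ∈ (upperMean p K' L').pts := by
    rw [mem_upperMean_iff] at hx ⊢
    intro b
    rw [real_inner_smul_right, inv_mul_le_iff₀ ht]
    by_cases hb : b = 0
    · rw [hb, inner_zero_left]
      exact mul_nonneg ht.le (pMean_nonneg p (K'.supp_nonneg _) (L'.supp_nonneg _))
    rw [← pMean_mul _ ht.le (K'.supp_nonneg _) (L'.supp_nonneg _)]
    exact (hx b).trans (pMean_mono p (K.supp_pos hb) (L.supp_pos hb) (hK b) (hL b))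
  have h2 := inner_le_supp h1 a
  rwa [real_inner_smul_right, inv_mul_le_iff₀ ht] at h2

theorem upperMean_within {p t : ℝ} (ht : 1 ≤ t) (h : Within t L K) :
    Within (pMean p 1 t) (upperMean p K L) K := by
  intro a
  have ht0 := one_pos.trans_le ht
  by_cases ha : a = 0
  · simp [ha, supp_zero]
  have hK := K.supp_pos ha
  refine (supp_upperMean_le p K L a).trans ?_
  rw [mul_comm, ← pMean_mul p hK.le zero_le_one ht0.le, mul_one, mul_comm]
  exact pMean_mono p hK (L.supp_pos ha) le_rfl (h a)

section

variable [NeZero n]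

/-- Polarity exchanges lower and upper means. -/
theorem polar_lowerMean (p : ℝ) (K L : OriginBody n) :
    (lowerMean p K L).polar = upperMean (-p) K.polar L.polar := by
  refine ext_pts (Set.ext fun a => ?_)
  have hval : ∀ x : Euc n, pMean (-p) (supportFun K.polar.pts x) (supportFun L.polar.pts x) =
      pMean (-p) (K.gau x) (L.gau x) := fun x => by
    rw [← supp_polar, ← supp_polar]
  constructor
  · intro h x hx
    have hpos := gaugeMean_pos (-p) K L (mem_sphere_zero_iff_norm.1 hx)
    have := h _ (subset_convexHull ℝ _ ⟨x, hx, rfl⟩)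
    rw [real_inner_smul_right, inv_mul_le_iff₀ hpos, mul_one, real_inner_comm] at this
    rwa [hval]
  · intro h
    have hsub : lowerMeanSet p K.pts L.pts ⊆ {x : Euc n | inner ℝ a x ≤ 1} := by
      refine convexHull_min ?_ ?_
      · rintro _ ⟨x, hx, rfl⟩
        have hpos := gaugeMean_pos (-p) K L (mem_sphere_zero_iff_norm.1 hx)
        have := h x hx
        rw [hval] at this
        simp only [mem_ofPred_eq]
        rwa [real_inner_smul_right, inv_mul_le_iff₀ hpos, mul_one, real_inner_comm]
      · exact convex_halfSpace_le ⟨fun x y => inner_add_right _ _ _,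
          fun c x => by rw [real_inner_smul_right, smul_eq_mul]⟩ 1
    exact fun x hx => hsub hx

theorem lowerMean_eq (p : ℝ) (K L : OriginBody n) :
    lowerMean p K L = (upperMean (-p) K.polar L.polar).polar := by
  rw [← polar_lowerMean, polar_polar]

theorem polar_upperMean (p : ℝ) (K L : OriginBody n) :
    (upperMean p K L).polar = lowerMean (-p) K.polar L.polar := by
  rw [lowerMean_eq, neg_neg, polar_polar, polar_polar]

theorem lowerMean_comm (p : ℝ) (K L : OriginBody n) : lowerMean p K L = lowerMean p L K := by
  rw [lowerMean_eq, upperMean_comm, ← lowerMean_eq]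

theorem lowerMean_self (p : ℝ) (K : OriginBody n) : lowerMean p K K = K := by
  rw [lowerMean_eq, upperMean_self, polar_polar]

theorem within_lowerMean {p t : ℝ} {K' L' : OriginBody n} (ht : 0 < t) (hK : Within t K K')
    (hL : Within t L L') : Within t (lowerMean p K L) (lowerMean p K' L') := by
  rw [lowerMean_eq, lowerMean_eq]
  exact (within_upperMean ht (hK.polar ht) (hL.polar ht)).polar ht

theorem gau_lowerMean_le (p : ℝ) (K L : OriginBody n) (x : Euc n) :
    (lowerMean p K L).gau x ≤ pMean (-p) (K.gau x) (L.gau x) := by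
  rw [lowerMean_eq, gau_polar, ← supp_polar, ← supp_polar]
  exact supp_upperMean_le _ _ _ _

theorem lowerMean_within_upperMean (p : ℝ) (K L : OriginBody n) :
    Within 1 (lowerMean p K L) (upperMean p K L) := by
  rw [within_one_iff]
  refine convexHull_min ?_ (upperMean p K L).1.convex
  rintro _ ⟨x, hx, rfl⟩
  have hx1 := mem_sphere_zero_iff_norm.1 hx
  have hx0 : x ≠ 0 := by rintro rfl; simp at hx1
  have hpos := gaugeMean_pos (-p) K L hx1
  refine mem_upperMean_iff.2 fun a => ?_
  simp only
  rw [real_inner_smul_right, inv_mul_le_iff₀ hpos]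
  rcases le_or_gt (inner ℝ a x) 0 with h0 | h0
  · exact h0.trans (mul_nonneg hpos.le (pMean_nonneg p (K.supp_nonneg _) (L.supp_nonneg _)))
  have ha : a ≠ 0 := by rintro rfl; simp at h0
  have hK := K.supp_pos ha
  have hL := L.supp_pos ha
  -- the gauge at `x` is at least `⟪a, x⟫` times the reciprocal of the support function at `a`
  have h1 : pMean (-p) (inner ℝ a x * (K.supp a)⁻¹) (inner ℝ a x * (L.supp a)⁻¹) ≤
      pMean (-p) (K.gau x) (L.gau x) := by
    refine pMean_mono _ (by positivity) (by positivity) ?_ ?_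
    · rw [← div_eq_mul_inv, div_le_iff₀ hK, mul_comm]; exact K.inner_le_supp_mul_gau a x
    · rw [← div_eq_mul_inv, div_le_iff₀ hL, mul_comm]; exact L.inner_le_supp_mul_gau a x
  rw [pMean_mul _ h0.le (by positivity) (by positivity), pMean_neg _ (by positivity)
    (by positivity), inv_inv, inv_inv] at h1
  have h2 := pMean_pos p hK hL
  rwa [← div_eq_mul_inv, div_le_iff₀ h2] at h1

end

/-! ### The Hausdorff topology in terms of multiplicative comparison -/

section Topology

variable {K L : OriginBody n}

theorem dist_le_of_within {R t : ℝ} (ht : 1 ≤ t) (hR : 0 ≤ R)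
    (hK : K.pts ⊆ Metric.closedBall 0 (t * R)) (hL : L.pts ⊆ Metric.closedBall 0 (t * R))
    (h : Within t K L) (h' : Within t L K) : dist K L ≤ (t - 1) * R := by
  have ht0 : 0 < t := by linarith
  have key : ∀ x ∈ Metric.closedBall (0 : Euc n) (t * R), dist x (t⁻¹ • x) ≤ (t - 1) * R := by
    intro x hx
    rw [mem_closedBall_zero_iff] at hx
    have h1 : 0 ≤ 1 - t⁻¹ := sub_nonneg.2 (inv_le_one_of_one_le₀ ht)
    calc dist x (t⁻¹ • x) = ‖(1 - t⁻¹) • x‖ := by rw [dist_eq_norm, sub_smul, one_smul]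
      _ = (1 - t⁻¹) * ‖x‖ := by rw [norm_smul, Real.norm_of_nonneg h1]
      _ ≤ (1 - t⁻¹) * (t * R) := by gcongr
      _ = (t - 1) * R := by field_simp
  exact Metric.hausdorffDist_le_of_mem_dist (mul_nonneg (by linarith) hR)
    (fun x hx => ⟨_, h.inv_smul_mem ht0 hx, key x (hK hx)⟩)
    (fun x hx => ⟨_, h'.inv_smul_mem ht0 hx, key x (hL hx)⟩)

theorem supp_le_of_dist_lt {ε : ℝ} (h : dist K L < ε) (a : Euc n) :
    K.supp a ≤ L.supp a + ε * ‖a‖ := by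
  refine supp_le fun x hx => ?_
  obtain ⟨y, hy, hxy⟩ := Metric.exists_dist_lt_of_hausdorffDist_lt hx
    (show Metric.hausdorffDist K.pts L.pts < ε from h) ConvexBody.hausdorffEDist_ne_top
  have h1 := real_inner_le_norm a (x - y)
  rw [inner_sub_right] at h1
  rw [dist_eq_norm] at hxy
  have h2 := inner_le_supp hy a
  have h3 := mul_le_mul_of_nonneg_left hxy.le (norm_nonneg a)
  linarith

/-- Convergence in the Hausdorff metric means that, for every `t > 1`, the bodies are eventually
within the factor `t` of the limit; the origin being interior to the limit matters here. -/
theorem tendsto_iff_within {ι : Type*} {l : Filter ι} {f : ι → OriginBody n} {G : OriginBody n} :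
    Tendsto f l (𝓝 G) ↔ ∀ t : ℝ, 1 < t → ∀ᶠ i in l, Within t (f i) G ∧ Within t G (f i) := by
  constructor
  · intro h t ht
    obtain ⟨r, hr, hrG⟩ := G.exists_ball_subset
    -- with `ε = r (t - 1) / t`, both `r + ε ≤ t r` and `r ≤ t (r - ε)` hold
    have hε : 0 < r * (t - 1) / t := by
      have : 0 < t - 1 := by linarith
      positivity
    filter_upwards [Metric.tendsto_nhds.1 h _ hε] with i hi
    have hb : ∀ a : Euc n, r * ‖a‖ ≤ G.supp a := by
      intro a
      by_cases ha : a = 0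
      · simp [ha, supp_zero]
      have hn : 0 < ‖a‖ := norm_pos_iff.2 ha
      have h2 := inner_le_supp (K := G) (x := (r / ‖a‖) • a) (hrG (by
        rw [mem_closedBall_zero_iff, norm_smul, Real.norm_of_nonneg (by positivity),
          div_mul_cancel₀ _ hn.ne'])) a
      rw [real_inner_smul_right, real_inner_self_eq_norm_sq] at h2
      calc r * ‖a‖ = r / ‖a‖ * ‖a‖ ^ 2 := by field_simp
        _ ≤ _ := h2
    constructor
    · intro a
      have h1 := supp_le_of_dist_lt hi a
      have h2 : r * (t - 1) / t * ‖a‖ ≤ (t - 1) * G.supp a :=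
        calc r * (t - 1) / t * ‖a‖ = (t - 1) / t * (r * ‖a‖) := by ring
          _ ≤ (t - 1) * G.supp a := by
            refine mul_le_mul (div_le_self (by linarith) ht.le) (hb a) (by positivity)
              (by linarith)
      linarith
    · intro a
      rw [dist_comm] at hi
      have h1 := supp_le_of_dist_lt hi a
      have h2 : r * (t - 1) / t * ‖a‖ ≤ (t - 1) / t * G.supp a :=
        calc r * (t - 1) / t * ‖a‖ = (t - 1) / t * (r * ‖a‖) := by ring
          _ ≤ _ := mul_le_mul_of_nonneg_left (hb a) (div_nonneg (by linarith) (by linarith))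
      have h3 : t * G.supp a ≤ t * (f i).supp a + (t - 1) * G.supp a := by
        have := mul_le_mul_of_nonneg_left (h1.trans (add_le_add_right h2 _))
          (by linarith : (0 : ℝ) ≤ t)
        have e : t * ((f i).supp a + (t - 1) / t * G.supp a) =
            t * (f i).supp a + (t - 1) * G.supp a := by
          field_simp
        linarith
      linarith
  · intro h
    rw [Metric.tendsto_nhds]
    intro ε hε
    obtain ⟨R, hR, hGR⟩ := G.exists_subset_ball
    set t : ℝ := 1 + ε / (2 * R) with ht
    have ht1 : 1 < t := by
      have : 0 < ε / (2 * R) := by positivity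
      linarith
    filter_upwards [h t ht1] with i hi
    have hle := dist_le_of_within ht1.le hR.le (K := f i) (L := G) (fun x hx => by
      have h1 := hGR (hi.1.inv_smul_mem (by linarith) hx)
      rw [mem_closedBall_zero_iff, norm_smul, norm_inv, Real.norm_of_nonneg (by linarith),
        inv_mul_le_iff₀ (by linarith)] at h1
      rwa [mem_closedBall_zero_iff])
      (hGR.trans (Metric.closedBall_subset_closedBall (le_mul_of_one_le_left hR.le ht1.le)))
      hi.1 hi.2
    have e : (t - 1) * R = ε / 2 := by rw [ht]; field_simp; ring
    linarith

theorem tendsto_supp {ι : Type*} {l : Filter ι} {f : ι → OriginBody n} {G : OriginBody n}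
    (h : Tendsto f l (𝓝 G)) (a : Euc n) :
    Tendsto (fun i => (f i).supp a) l (𝓝 (G.supp a)) := by
  have key : ∀ K L : OriginBody n, K.supp a ≤ L.supp a + dist K L * ‖a‖ := fun K L => by
    have hlim : Tendsto (fun ε : ℝ => L.supp a + ε * ‖a‖) (𝓝[>] dist K L)
        (𝓝 (L.supp a + dist K L * ‖a‖)) :=
      (Continuous.tendsto (by fun_prop) _).mono_left nhdsWithin_le_nhds
    exact ge_of_tendsto hlim
      (eventually_nhdsWithin_of_forall fun ε hε => supp_le_of_dist_lt hε a)
  have hd : Tendsto (fun i => dist (f i) G * ‖a‖) l (𝓝 0) := by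
    simpa using (tendsto_iff_dist_tendsto_zero.1 h).mul_const ‖a‖
  rw [tendsto_iff_dist_tendsto_zero]
  refine squeeze_zero (fun _ => dist_nonneg) (fun i => ?_) hd
  rw [Real.dist_eq, abs_le]
  have h1 := key (f i) G
  have h2 := key G (f i)
  rw [dist_comm] at h2
  constructor <;> linarith

theorem within_of_tendsto {ι : Type*} {l : Filter ι} [l.NeBot] {f g : ι → OriginBody n}
    {F G : OriginBody n} {t : ℝ} (hf : Tendsto f l (𝓝 F)) (hg : Tendsto g l (𝓝 G))
    (h : ∀ i, Within t (f i) (g i)) : Within t F G := fun a =>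
  le_of_tendsto_of_tendsto' (tendsto_supp hf a) ((tendsto_supp hg a).const_mul t) fun i => h i a

theorem tendsto_polar {ι : Type*} {l : Filter ι} {f : ι → OriginBody n} {G : OriginBody n}
    (h : Tendsto f l (𝓝 G)) : Tendsto (fun i => (f i).polar) l (𝓝 G.polar) := by
  rw [tendsto_iff_within] at h ⊢
  intro t ht
  filter_upwards [h t ht] with i hi
  exact ⟨hi.2.polar (by linarith), hi.1.polar (by linarith)⟩

/-- A completeness statement: bodies that get uniformly close to all their successors in the
multiplicative sense converge, the limit being `⋂ i, tᵢ Kᵢ`. -/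
theorem exists_tendsto_of_within (K : ℕ → OriginBody n) (t : ℕ → ℝ) (ht : ∀ i, 1 ≤ t i)
    (ht1 : Tendsto t atTop (𝓝 1)) (h : ∀ i j, i ≤ j → Within (t i) (K i) (K j))
    (h' : ∀ i j, i ≤ j → Within (t i) (K j) (K i)) : ∃ G, Tendsto K atTop (𝓝 G) := by
  have ht0 : ∀ i, 0 < t i := fun i => one_pos.trans_le (ht i)
  have hij : ∀ i j, Within (t i * t j) (K i) (K j) := by
    intro i j
    rcases le_total i j with hle | hle
    · exact (h i j hle).mono (le_mul_of_one_le_right (ht0 i).le (ht j))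
    · exact (h' j i hle).mono (le_mul_of_one_le_left (ht0 j).le (ht i))
  let S : Set (Euc n) := ⋂ i, (fun x => (t i)⁻¹ • x) ⁻¹' (K i).pts
  have hconv : Convex ℝ S := convex_iInter fun i =>
    (K i).1.convex.linear_preimage ((t i)⁻¹ • (LinearMap.id : Euc n →ₗ[ℝ] Euc n))
  have hclosed : IsClosed S := isClosed_iInter fun i =>
    (K i).1.isClosed.preimage (continuous_const_smul _)
  have hsub : ∀ i x, x ∈ (K i).pts → (t i)⁻¹ • x ∈ S := by
    intro i x hx
    refine mem_iInter.2 fun j => ?_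
    have := (hij i j).inv_smul_mem (mul_pos (ht0 i) (ht0 j)) hx
    simp only [mem_preimage]
    rwa [smul_smul, ← mul_inv, mul_comm]
  have hcomp : IsCompact S := by
    refine ((K 0).1.isCompact.smul (t 0)).of_isClosed_subset hclosed fun x hx => ?_
    exact ⟨_, mem_iInter.1 hx 0, smul_inv_smul₀ (ht0 0).ne' x⟩
  have h0 : S ∈ 𝓝 (0 : Euc n) := by
    refine mem_of_superset ((set_smul_mem_nhds_zero_iff (inv_ne_zero (ht0 0).ne')).2
      (K 0).pts_mem_nhds) ?_
    rintro _ ⟨x, hx, rfl⟩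
    exact hsub 0 x hx
  let G : OriginBody n := ⟨⟨S, hconv, hcomp, ⟨0, mem_of_mem_nhds h0⟩⟩,
    mem_interior_iff_mem_nhds.2 h0⟩
  have hmem : ∀ {i : ℕ} {A B : OriginBody n}, (∀ x ∈ A.pts, (t i)⁻¹ • x ∈ B.pts) →
      Within (t i) A B := by
    intro i A B hAB a
    refine supp_le fun x hx => ?_
    have := inner_le_supp (hAB x hx) a
    rwa [real_inner_smul_right, inv_mul_le_iff₀ (ht0 i)] at this
  refine ⟨G, tendsto_iff_within.2 fun s hs => ?_⟩
  filter_upwards [ht1.eventually_le_const hs] with i hi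
  exact ⟨(hmem fun x hx => hsub i x hx).mono hi,
    (hmem fun x hx => mem_iInter.1 hx i).mono hi⟩

end Topology

/-! ### Convergence of the iterated means -/

section Iteration

variable [NeZero n]

/-- One step of the iteration, as a map on pairs of bodies. -/
def step (p : ℝ) (q : OriginBody n × OriginBody n) : OriginBody n × OriginBody n :=
  (upperMean p q.1 q.2, lowerMean (-p) q.1 q.2)

theorem iterMean_eq_iterate (p : ℝ) (K L : OriginBody n) (i : ℕ) :
    iterMean p K L i = (step p)^[i + 1] (K, L) := by
  induction i with
  | zero => rfl
  | succ i ih => rw [Function.iterate_succ_apply', ← ih]; rfl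

theorem step_self (p : ℝ) (K : OriginBody n) : step p (K, K) = (K, K) := by
  simp only [step, upperMean_self, lowerMean_self]

theorem step_swap (p : ℝ) (q : OriginBody n × OriginBody n) : step p q.swap = step p q := by
  simp only [step, Prod.fst_swap, Prod.snd_swap, upperMean_comm p q.2, lowerMean_comm (-p) q.2]

theorem within_iterate_step {p t : ℝ} (ht : 0 < t) {K L K' L' : OriginBody n} (hK : Within t K K')
    (hL : Within t L L') (i : ℕ) :
    Within t ((step p)^[i] (K, L)).1 ((step p)^[i] (K', L')).1 ∧
      Within t ((step p)^[i] (K, L)).2 ((step p)^[i] (K', L')).2 := by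
  induction i with
  | zero => exact ⟨hK, hL⟩
  | succ i ih =>
    rw [Function.iterate_succ_apply', Function.iterate_succ_apply']
    exact ⟨within_upperMean ht ih.1 ih.2, within_lowerMean ht ih.1 ih.2⟩

theorem iterate_step_self (p : ℝ) (K : OriginBody n) (i : ℕ) :
    (step p)^[i] (K, K) = (K, K) := Function.iterate_fixed (step_self p K) i

/-- The factor by which two bodies within the factor `t` of each other are comparable after one
step of the iteration. -/
def contraction (p t : ℝ) : ℝ := max (pMean p 1 t) (pMean (-p) 1 t)

theorem contraction_lt {p t : ℝ} (ht : 1 < t) : contraction p t < t :=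
  max_lt (pMean_one_lt p ht) (pMean_one_lt (-p) ht)

theorem one_le_contraction {p t : ℝ} (ht : 1 ≤ t) : 1 ≤ contraction p t :=
  le_max_of_le_left (by simpa [ht] using min_le_pMean p one_pos (one_pos.trans_le ht))

theorem contraction_le {p t : ℝ} (ht : 1 ≤ t) : contraction p t ≤ t := by
  have h0 := one_pos.trans_le ht
  exact max_le (by simpa [ht] using pMean_le_max p one_pos h0)
    (by simpa [ht] using pMean_le_max (-p) one_pos h0)

theorem continuousOn_contraction (p : ℝ) : ContinuousOn (contraction p) (Ioi 0) := by
  have h : ∀ q : ℝ, ContinuousOn (fun t : ℝ => pMean q 1 t) (Ioi 0) := fun q =>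
    continuousOn_pMean q continuousOn_const continuousOn_id (fun _ _ => one_pos) fun _ h => h
  exact (h p).sup (h (-p))

theorem tendsto_iterate_contraction (p : ℝ) {t : ℝ} (ht : 1 ≤ t) :
    (∀ i, 1 ≤ (contraction p)^[i] t) ∧
      Tendsto (fun i => (contraction p)^[i] t) atTop (𝓝 1) := by
  have h1 : ∀ i, 1 ≤ (contraction p)^[i] t := by
    intro i
    induction i with
    | zero => exact ht
    | succ i ih => rw [Function.iterate_succ_apply']; exact one_le_contraction ih
  refine ⟨h1, ?_⟩
  have hanti : Antitone fun i => (contraction p)^[i] t := antitone_nat_of_succ_le fun i => by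
    rw [Function.iterate_succ_apply']
    exact contraction_le (h1 i)
  have hlim := tendsto_atTop_ciInf hanti ⟨1, by rintro _ ⟨i, rfl⟩; exact h1 i⟩
  set ℓ := ⨅ i, (contraction p)^[i] t
  have hℓ : 1 ≤ ℓ := le_ciInf h1
  have h2 : Tendsto (fun i => (contraction p)^[i + 1] t) atTop (𝓝 (contraction p ℓ)) := by
    simp only [Function.iterate_succ_apply']
    exact (((continuousOn_contraction p).continuousAt
      (Ioi_mem_nhds (one_pos.trans_le hℓ))).tendsto).comp hlim
  have h3 := tendsto_nhds_unique h2 (hlim.comp (tendsto_add_atTop_nat 1))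
  rcases hℓ.eq_or_lt with h | h
  · rwa [h]
  · exact absurd h3 (contraction_lt h).ne

/-- The two means are closer to each other than the two given bodies: the upper `p`-mean lies in
`c K` and in `c L`, hence in the `c`-fold of any lower mean. -/
theorem within_step {p t : ℝ} {K L : OriginBody n} (ht : 1 ≤ t) (h : Within t K L)
    (h' : Within t L K) :
    Within (contraction p t) (step p (K, L)).1 (step p (K, L)).2 ∧
      Within (contraction p t) (step p (K, L)).2 (step p (K, L)).1 := by
  have ht0 := one_pos.trans_le ht
  have hc : 0 < contraction p t := one_pos.trans_le (one_le_contraction ht)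
  have hK : ∀ q, Within (pMean q 1 t) (upperMean q K L) K := fun q => upperMean_within ht h'
  have hL : ∀ q, Within (pMean q 1 t) (upperMean q K L) L := fun q => by
    rw [upperMean_comm]; exact upperMean_within ht h
  constructor
  · have := within_lowerMean (p := -p) hc ((hK p).mono (le_max_left _ _))
      ((hL p).mono (le_max_left _ (pMean (-p) 1 t)))
    rwa [lowerMean_self] at this
  · have hlow : ∀ {M}, Within (pMean (-p) 1 t) (upperMean (-p) K L) M →
        Within (contraction p t) (lowerMean (-p) K L) M := fun hM => by
      have := (lowerMean_within_upperMean (-p) K L).trans hM zero_le_one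
      rw [one_mul] at this
      exact this.mono (le_max_right _ _)
    have := within_upperMean (p := p) hc (hlow (hK (-p))) (hlow (hL (-p)))
    rwa [upperMean_self] at this

theorem exists_tendsto_iterate_step (p : ℝ) (K L : OriginBody n) :
    ∃ G, Tendsto (fun i => ((step p)^[i] (K, L)).1) atTop (𝓝 G) ∧
      Tendsto (fun i => ((step p)^[i] (K, L)).2) atTop (𝓝 G) := by
  obtain ⟨t₁, ht₁, h₁⟩ := exists_within K L
  obtain ⟨t₂, ht₂, h₂⟩ := exists_within L K
  set t₀ := max t₁ t₂
  have ht₀ : 1 ≤ t₀ := ht₁.le.trans (le_max_left _ _)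
  set t : ℕ → ℝ := fun i => (contraction p)^[i] t₀ with ht
  obtain ⟨ht1, hlim⟩ := tendsto_iterate_contraction p ht₀
  set q : ℕ → OriginBody n × OriginBody n := fun i => (step p)^[i] (K, L) with hq
  have hclose : ∀ i, Within (t i) (q i).1 (q i).2 ∧ Within (t i) (q i).2 (q i).1 := by
    intro i
    induction i with
    | zero => exact ⟨h₁.mono (le_max_left _ _), h₂.mono (le_max_right _ _)⟩
    | succ i ih =>
      simp only [hq, ht, Function.iterate_succ_apply']
      exact within_step (ht1 i) ih.1 ih.2
  have hadd : ∀ i k, q (i + k) = (step p)^[k] ((q i).1, (q i).2) := fun i k => by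
    simp only [hq, add_comm i k, Function.iterate_add_apply]
  have ht0 : ∀ i, 0 < t i := fun i => one_pos.trans_le (ht1 i)
  obtain ⟨G, hG⟩ := exists_tendsto_of_within (fun i => (q i).1) t ht1 hlim
    (by
      intro i j hij
      obtain ⟨k, rfl⟩ := Nat.exists_eq_add_of_le hij
      have := (within_iterate_step (p := p) (ht0 i) (within_refl (ht1 i) (q i).1) (hclose i).1 k).1
      rwa [iterate_step_self, ← hadd] at this)
    (by
      intro i j hij
      obtain ⟨k, rfl⟩ := Nat.exists_eq_add_of_le hij
      have := (within_iterate_step (p := p) (ht0 i) (within_refl (ht1 i) (q i).1) (hclose i).2 k).1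
      rwa [iterate_step_self, ← hadd] at this)
  refine ⟨G, hG, tendsto_iff_within.2 fun s hs => ?_⟩
  have hs' : 1 < √s := by rw [Real.lt_sqrt zero_le_one]; simpa
  filter_upwards [tendsto_iff_within.1 hG _ hs', hlim.eventually_le_const hs'] with i hi hti
  have e : √s * √s = s := Real.mul_self_sqrt (by linarith)
  exact ⟨e ▸ ((hclose i).2.mono hti).trans hi.1 (by positivity),
    e ▸ hi.2.trans ((hclose i).1.mono hti) (by positivity)⟩

theorem tendsto_iterate_step (p : ℝ) (K L : OriginBody n) :
    Tendsto (fun i => ((step p)^[i] (K, L)).1) atTop (𝓝 (geomMean p K L)) ∧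
      Tendsto (fun i => ((step p)^[i] (K, L)).2) atTop (𝓝 (geomMean p K L)) := by
  obtain ⟨G, h1, h2⟩ := exists_tendsto_iterate_step p K L
  have h3 : Tendsto (fun i => (iterMean p K L i).1) atTop (𝓝 G) := by
    simp only [iterMean_eq_iterate]
    exact h1.comp (tendsto_add_atTop_nat 1)
  have h4 : geomMean p K L = G := h3.limUnder_eq
  rw [h4]
  exact ⟨h1, h2⟩

theorem tendsto_iterMean (p : ℝ) (K L : OriginBody n) :
    Tendsto (fun i => (iterMean p K L i).1) atTop (𝓝 (geomMean p K L)) ∧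
      Tendsto (fun i => (iterMean p K L i).2) atTop (𝓝 (geomMean p K L)) := by
  simp only [iterMean_eq_iterate]
  exact ⟨(tendsto_iterate_step p K L).1.comp (tendsto_add_atTop_nat 1),
    (tendsto_iterate_step p K L).2.comp (tendsto_add_atTop_nat 1)⟩

theorem geomMean_eq_of_tendsto {p : ℝ} {K L G : OriginBody n}
    (h : Tendsto (fun i => ((step p)^[i] (K, L)).1) atTop (𝓝 G)) : geomMean p K L = G :=
  tendsto_nhds_unique (tendsto_iterate_step p K L).1 h

/-! ### Invariance properties of the geometric mean -/

theorem geomMean_self (p : ℝ) (K : OriginBody n) : geomMean p K K = K :=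
  geomMean_eq_of_tendsto (by simp only [iterate_step_self, tendsto_const_nhds_iff])

/-- The geometric mean is invariant under a step of the iteration. -/
theorem geomMean_step (p : ℝ) (K L : OriginBody n) :
    geomMean p (upperMean p K L) (lowerMean (-p) K L) = geomMean p K L :=
  geomMean_eq_of_tendsto (by
    have := (tendsto_iterate_step p K L).1.comp (tendsto_add_atTop_nat 1)
    simpa only [Function.comp_def, Function.iterate_succ_apply, step] using this)

theorem geomMean_comm (p : ℝ) (K L : OriginBody n) : geomMean p K L = geomMean p L K := by
  rw [← geomMean_step, ← geomMean_step p L, upperMean_comm, lowerMean_comm]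

/-- With `t = 1` this is monotonicity; applied in both directions with `t` close to `1` it is
continuity, and with `K` and `K'` dilates of each other it is homogeneity. -/
theorem within_geomMean {p t : ℝ} (ht : 0 < t) {K L K' L' : OriginBody n} (hK : Within t K K')
    (hL : Within t L L') : Within t (geomMean p K L) (geomMean p K' L') :=
  within_of_tendsto (tendsto_iterate_step p K L).1 (tendsto_iterate_step p K' L').1
    fun i => (within_iterate_step ht hK hL i).1

theorem geomMean_mono (p : ℝ) {K L K' L' : OriginBody n} (hK : K.pts ⊆ K'.pts)
    (hL : L.pts ⊆ L'.pts) : (geomMean p K L).pts ⊆ (geomMean p K' L').pts :=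
  within_one_iff.1 (within_geomMean one_pos (within_one_iff.2 hK) (within_one_iff.2 hL))

theorem continuous_geomMean (p : ℝ) :
    Continuous fun q : OriginBody n × OriginBody n => geomMean p q.1 q.2 := by
  refine continuous_iff_continuousAt.2 fun q => tendsto_iff_within.2 fun t ht => ?_
  have ht0 : 0 < t := by linarith
  filter_upwards [tendsto_iff_within.1 (continuous_fst.tendsto q) t ht,
    tendsto_iff_within.1 (continuous_snd.tendsto q) t ht] with q' h1 h2
  exact ⟨within_geomMean ht0 h1.1 h2.1, within_geomMean ht0 h1.2 h2.2⟩

theorem iterate_step_polar (p : ℝ) (K L : OriginBody n) (i : ℕ) :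
    (step p)^[i + 1] (K.polar, L.polar) =
      (((step p)^[i + 1] (K, L)).2.polar, ((step p)^[i + 1] (K, L)).1.polar) := by
  have key : ∀ A B : OriginBody n, step p (A.polar, B.polar) =
      ((step p (A, B)).2.polar, (step p (A, B)).1.polar) := fun A B => by
    simp only [step, polar_lowerMean, polar_upperMean, neg_neg]
  induction i with
  | zero => exact key K L
  | succ i ih =>
    rw [Function.iterate_succ_apply', ih, key, Function.iterate_succ_apply' _ (i + 1) (K, L)]
    have := step_swap p ((step p)^[i + 1] (K, L))
    rw [show (((step p)^[i + 1] (K, L)).2, ((step p)^[i + 1] (K, L)).1) =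
      ((step p)^[i + 1] (K, L)).swap from rfl, this]

theorem polar_geomMean (p : ℝ) (K L : OriginBody n) :
    (geomMean p K L).polar = geomMean p K.polar L.polar := by
  have h1 := (tendsto_iterate_step p K.polar L.polar).1.comp (tendsto_add_atTop_nat 1)
  simp only [Function.comp_def, iterate_step_polar] at h1
  exact tendsto_nhds_unique
    (tendsto_polar ((tendsto_iterate_step p K L).2.comp (tendsto_add_atTop_nat 1))) h1

end Iteration

/-! ### Linear images -/

section LinearImage

variable {K L : OriginBody n} {A : Matrix (Fin n) (Fin n) ℝ}

theorem inner_toEuclideanLin (A : Matrix (Fin n) (Fin n) ℝ) (a x : Euc n) :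
    inner ℝ a (Matrix.toEuclideanLin A x) =
      inner ℝ (Matrix.toEuclideanLin A.transpose a) x := by
  rw [← Matrix.conjTranspose_eq_transpose_of_trivial,
    Matrix.toEuclideanLin_conjTranspose_eq_adjoint, LinearMap.adjoint_inner_left]

theorem toEuclideanLin_mul_apply (A B : Matrix (Fin n) (Fin n) ℝ) (x : Euc n) :
    Matrix.toEuclideanLin A (Matrix.toEuclideanLin B x) = Matrix.toEuclideanLin (A * B) x := by
  simp [Matrix.toLpLin_apply, Matrix.mulVec_mulVec]

theorem toEuclideanLin_one_apply (x : Euc n) :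
    Matrix.toEuclideanLin (1 : Matrix (Fin n) (Fin n) ℝ) x = x := by
  simp

theorem toEuclideanLin_bijective (hA : IsUnit A) :
    Function.Bijective (Matrix.toEuclideanLin A) := by
  obtain ⟨⟨A, B, hAB, hBA⟩, rfl⟩ := hA
  exact Function.bijective_iff_has_inverse.2 ⟨Matrix.toEuclideanLin B,
    fun x => by simp [toEuclideanLin_mul_apply, hBA],
    fun x => by simp [toEuclideanLin_mul_apply, hAB]⟩

theorem supp_linImage (hA : IsUnit A) (K : OriginBody n) (a : Euc n) :
    (linImage A hA K).supp a = K.supp (Matrix.toEuclideanLin A.transpose a) := by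
  apply le_antisymm
  · refine supp_le ?_
    rintro _ ⟨x, hx, rfl⟩
    rw [inner_toEuclideanLin]
    exact inner_le_supp hx _
  · refine supp_le fun x hx => ?_
    rw [← inner_toEuclideanLin]
    exact inner_le_supp (K := linImage A hA K) ⟨x, hx, rfl⟩ a

theorem toEuclideanLin_mem_linImage (hA : IsUnit A) {x : Euc n} :
    Matrix.toEuclideanLin A x ∈ (linImage A hA K).pts ↔ x ∈ K.pts :=
  (toEuclideanLin_bijective hA).1.mem_set_image

theorem within_linImage (hA : IsUnit A) {t : ℝ} (h : Within t K L) :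
    Within t (linImage A hA K) (linImage A hA L) := fun a => by
  rw [supp_linImage, supp_linImage]
  exact h _

theorem polar_linImage (hA : IsUnit A) (hB : IsUnit A⁻¹.transpose) (K : OriginBody n) :
    (linImage A hA K).polar = linImage A⁻¹.transpose hB K.polar := by
  have hdet : IsUnit A.det := (Matrix.isUnit_iff_isUnit_det A).1 hA
  refine ext_pts (Set.ext fun a => ?_)
  obtain ⟨b, rfl⟩ := (toEuclideanLin_bijective hB).2 a
  rw [toEuclideanLin_mem_linImage, mem_polar_iff, mem_polar_iff, supp_linImage,
    toEuclideanLin_mul_apply, ← Matrix.transpose_mul, Matrix.nonsing_inv_mul _ hdet,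
    Matrix.transpose_one, toEuclideanLin_one_apply]

theorem isUnit_inv_transpose (hA : IsUnit A) : IsUnit A⁻¹.transpose :=
  (Matrix.isUnit_transpose _).2 (Matrix.isUnit_nonsing_inv_iff.2 hA)

theorem upperMean_linImage (p : ℝ) (hA : IsUnit A) (K L : OriginBody n) :
    upperMean p (linImage A hA K) (linImage A hA L) = linImage A hA (upperMean p K L) := by
  refine ext_pts (Set.ext fun y => ?_)
  obtain ⟨x, rfl⟩ := (toEuclideanLin_bijective hA).2 y
  have hT : IsUnit A.transpose := (Matrix.isUnit_transpose A).2 hA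
  rw [toEuclideanLin_mem_linImage, mem_upperMean_iff, mem_upperMean_iff]
  simp only [supp_linImage, inner_toEuclideanLin]
  exact ⟨fun h a => by
    obtain ⟨b, rfl⟩ := (toEuclideanLin_bijective hT).2 a
    exact h b, fun h a => h _⟩

/-- The unit ball is the only self-polar body. -/
theorem eq_unitBall_of_polar_eq {G : OriginBody n} (h : G.polar = G) : G = unitBall n := by
  have h1 : Within 1 G (unitBall n) := within_one_iff.2 fun x hx => by
    have h2 : x ∈ G.polar.pts := by rwa [h]
    have h3 : inner ℝ x x ≤ 1 := h2 x hx
    rw [real_inner_self_eq_norm_sq] at h3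
    exact mem_closedBall_zero_iff.2 (by nlinarith [norm_nonneg x])
  have h4 : Within 1 (unitBall n) (unitBall n).polar := within_one_iff.2 fun x hx y hy => by
    calc inner ℝ x y ≤ ‖x‖ * ‖y‖ := real_inner_le_norm x y
      _ ≤ 1 * 1 := mul_le_mul (mem_closedBall_zero_iff.1 hx) (mem_closedBall_zero_iff.1 hy)
          (norm_nonneg _) zero_le_one
      _ = 1 := one_mul 1
  have h5 : Within 1 (unitBall n) G := by
    have := h4.trans (h1.polar one_pos) zero_le_one
    rwa [h, one_mul] at this
  exact ext_pts (Subset.antisymm (within_one_iff.1 h1) (within_one_iff.1 h5))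

variable [NeZero n]

theorem lowerMean_linImage (p : ℝ) (hA : IsUnit A) (K L : OriginBody n) :
    lowerMean p (linImage A hA K) (linImage A hA L) = linImage A hA (lowerMean p K L) := by
  apply polar_injective
  rw [polar_lowerMean, polar_linImage hA (isUnit_inv_transpose hA),
    polar_linImage hA (isUnit_inv_transpose hA), upperMean_linImage, ← polar_lowerMean,
    ← polar_linImage hA]

theorem geomMean_linImage (p : ℝ) (hA : IsUnit A) (K L : OriginBody n) :
    geomMean p (linImage A hA K) (linImage A hA L) = linImage A hA (geomMean p K L) := by
  have key : ∀ i, (step p)^[i] (linImage A hA K, linImage A hA L) =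
      (linImage A hA ((step p)^[i] (K, L)).1, linImage A hA ((step p)^[i] (K, L)).2) := by
    intro i
    induction i with
    | zero => rfl
    | succ i ih =>
      rw [Function.iterate_succ_apply', ih, Function.iterate_succ_apply']
      simp only [step, upperMean_linImage, lowerMean_linImage]
  refine geomMean_eq_of_tendsto ?_
  simp only [key]
  rw [tendsto_iff_within]
  intro t ht
  filter_upwards [tendsto_iff_within.1 (tendsto_iterate_step p K L).1 t ht] with i hi
  exact ⟨within_linImage hA hi.1, within_linImage hA hi.2⟩

theorem geomMean_polar_self (p : ℝ) (K : OriginBody n) : geomMean p K K.polar = unitBall n :=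
  eq_unitBall_of_polar_eq (by rw [polar_geomMean, polar_polar, geomMean_comm])

/-- With `S = P^{1/2}`, the pair `(P K, K°)` is the image under `S` of `(S K, (S K)°)`. -/
theorem geomMean_posDef (p : ℝ) {P : Matrix (Fin n) (Fin n) ℝ} (hP : P.PosDef)
    (K : OriginBody n) :
    (geomMean p (linImage P hP.isUnit K) K.polar).pts =
      Matrix.toEuclideanLin (CFC.sqrt P) '' Metric.closedBall (0 : Euc n) 1 := by
  set S := CFC.sqrt P with hS
  have hSS : S * S = P := CFC.sqrt_mul_sqrt_self P (Matrix.nonneg_iff_posSemidef.2 hP.posSemidef)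
  have hST : S.transpose = S := by
    have : S.PosSemidef := Matrix.nonneg_iff_posSemidef.1 (CFC.sqrt_nonneg P)
    rw [← Matrix.conjTranspose_eq_transpose_of_trivial]
    exact this.1
  have hSu : IsUnit S := by
    have h1 : IsUnit (S * S) := hSS ▸ hP.isUnit
    rw [Matrix.isUnit_iff_isUnit_det, Matrix.det_mul] at h1
    exact (Matrix.isUnit_iff_isUnit_det S).2 (isUnit_of_mul_isUnit_left h1)
  have hdet : IsUnit S.det := (Matrix.isUnit_iff_isUnit_det S).1 hSu
  have e1 : linImage P hP.isUnit K = linImage S hSu (linImage S hSu K) :=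
    ext_supp fun a => by
      rw [supp_linImage, supp_linImage, supp_linImage, toEuclideanLin_mul_apply,
        ← Matrix.transpose_mul, hSS]
  have e2 : K.polar = linImage S hSu (linImage S hSu K).polar :=
    ext_supp fun a => by
      rw [polar_linImage hSu (isUnit_inv_transpose hSu), supp_linImage, supp_linImage,
        toEuclideanLin_mul_apply, Matrix.transpose_transpose, hST, Matrix.nonsing_inv_mul _ hdet,
        toEuclideanLin_one_apply]
  rw [e1, e2, geomMean_linImage, geomMean_polar_self]
  rfl

end LinearImage

/-! ### Dilates -/

section Dilates

variable {K L : OriginBody n}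

theorem mem_scale_iff {α : ℝ} (hα : 0 < α) {x : Euc n} :
    x ∈ (scale α hα K).pts ↔ α⁻¹ • x ∈ K.pts := by
  change x ∈ ((α • K.1 : ConvexBody (Euc n)) : Set (Euc n)) ↔ _
  rw [ConvexBody.coe_smul, mem_smul_set_iff_inv_smul_mem₀ hα.ne']

theorem supp_scale {α : ℝ} (hα : 0 < α) (K : OriginBody n) (a : Euc n) :
    (scale α hα K).supp a = α * K.supp a := by
  apply le_antisymm
  · refine supp_le fun x hx => ?_
    have := inner_le_supp ((mem_scale_iff hα).1 hx) a
    rwa [real_inner_smul_right, inv_mul_le_iff₀ hα] at this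
  · rw [← le_inv_mul_iff₀ hα]
    refine supp_le fun x hx => ?_
    rw [le_inv_mul_iff₀ hα, ← real_inner_smul_right]
    refine inner_le_supp ((mem_scale_iff hα).2 ?_) a
    rwa [inv_smul_smul₀ hα.ne']

theorem polar_scale {α : ℝ} (hα : 0 < α) (K : OriginBody n) :
    (scale α hα K).polar = scale α⁻¹ (inv_pos.2 hα) K.polar := by
  refine ext_pts (Set.ext fun a => ?_)
  rw [mem_polar_iff, mem_scale_iff, mem_polar_iff, supp_scale, inv_inv, supp_smul _ hα.le]

theorem scale_one (h : (0 : ℝ) < 1) (K : OriginBody n) : scale 1 h K = K :=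
  ext_supp fun a => by rw [supp_scale, one_mul]

theorem isDilatate_iff : IsDilatate K L ↔ ∃ c, ∃ hc : 0 < c, K = scale c hc L := by
  have hpts : ∀ (c : ℝ) (hc : 0 < c), (scale c hc L).pts = c • L.pts := fun c hc =>
    ConvexBody.coe_smul c L.1
  constructor
  · rintro ⟨c, hc, h⟩
    exact ⟨c, hc, ext_pts (h.trans (hpts c hc).symm)⟩
  · rintro ⟨c, hc, h⟩
    exact ⟨c, hc, by rw [h, hpts]⟩

theorem IsDilatate.polar (h : IsDilatate K L) : IsDilatate K.polar L.polar := by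
  obtain ⟨c, hc, rfl⟩ := isDilatate_iff.1 h
  exact isDilatate_iff.2 ⟨c⁻¹, inv_pos.2 hc, polar_scale hc L⟩

theorem isDilatate_polar_iff : IsDilatate K.polar L.polar ↔ IsDilatate K L :=
  ⟨fun h => by simpa only [polar_polar] using h.polar, IsDilatate.polar⟩

theorem upperMean_zero_scale {α β : ℝ} (hα : 0 < α) (hβ : 0 < β) (h : 0 < √(α * β))
    (K L : OriginBody n) :
    upperMean 0 (scale α hα K) (scale β hβ L) = scale (√(α * β)) h (upperMean 0 K L) := by
  refine ext_pts (Set.ext fun x => ?_)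
  rw [mem_scale_iff, mem_upperMean_iff, mem_upperMean_iff]
  refine forall_congr' fun a => ?_
  rw [supp_scale, supp_scale, real_inner_smul_right, inv_mul_le_iff₀ h]
  simp only [pMean, if_true]
  rw [← Real.sqrt_mul (by positivity), mul_mul_mul_comm]

variable [NeZero n]

theorem lowerMean_zero_scale {α β : ℝ} (hα : 0 < α) (hβ : 0 < β) (h : 0 < √(α * β))
    (K L : OriginBody n) :
    lowerMean 0 (scale α hα K) (scale β hβ L) = scale (√(α * β)) h (lowerMean 0 K L) := by
  have e : √(α⁻¹ * β⁻¹) = (√(α * β))⁻¹ := by rw [← mul_inv, Real.sqrt_inv]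
  apply polar_injective
  rw [polar_lowerMean, polar_scale, polar_scale, polar_scale, neg_zero,
    upperMean_zero_scale _ _ (by rw [e]; positivity), polar_lowerMean, neg_zero]
  simp only [e]

theorem geomMean_scale (p : ℝ) {γ : ℝ} (hγ : 0 < γ) (K L : OriginBody n) :
    geomMean p (scale γ hγ K) (scale γ hγ L) = scale γ hγ (geomMean p K L) := by
  have h1 : ∀ M : OriginBody n, Within γ (scale γ hγ M) M := fun M a => (supp_scale hγ M a).le
  have h2 : ∀ M : OriginBody n, Within γ⁻¹ M (scale γ hγ M) := fun M a => by
    rw [supp_scale, inv_mul_cancel_left₀ hγ.ne']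
  refine ext_supp fun a => ?_
  rw [supp_scale]
  refine le_antisymm (within_geomMean hγ (h1 K) (h1 L) a) ?_
  rw [← le_inv_mul_iff₀ hγ]
  exact within_geomMean (inv_pos.2 hγ) (h2 K) (h2 L) a

theorem geomMean_zero_scale {α β : ℝ} (hα : 0 < α) (hβ : 0 < β) (h : 0 < √(α * β))
    (K L : OriginBody n) :
    geomMean 0 (scale α hα K) (scale β hβ L) = scale (√(α * β)) h (geomMean 0 K L) := by
  rw [← geomMean_step, neg_zero, upperMean_zero_scale hα hβ h, lowerMean_zero_scale hα hβ h,
    geomMean_scale]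
  conv_rhs => rw [← geomMean_step, neg_zero]

/-! ### Position between the lower and the upper `0`-mean -/

/-- The product `h_U h_W` of the support functions does not increase along the iteration, because
`m_p(a, b) m_{-p}(a, b) = a b`. -/
theorem supp_step_mul_le (p : ℝ) (K L : OriginBody n) (a : Euc n) :
    (upperMean p K L).supp a * (lowerMean (-p) K L).supp a ≤ K.supp a * L.supp a := by
  by_cases ha : a = 0
  · simp [ha, supp_zero]
  have hK := K.supp_pos ha
  have hL := L.supp_pos ha
  have h1 := lowerMean_within_upperMean (-p) K L a
  rw [one_mul] at h1
  rw [← pMean_mul_pMean_neg p hK hL]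
  exact mul_le_mul (supp_upperMean_le p K L a) (h1.trans (supp_upperMean_le (-p) K L a))
    (supp_nonneg _ _) (pMean_nonneg p hK.le hL.le)

theorem geomMean_subset_upperMean_zero (p : ℝ) (K L : OriginBody n) :
    (geomMean p K L).pts ⊆ (upperMean 0 K L).pts := by
  intro x hx
  refine mem_upperMean_iff.2 fun a => (inner_le_supp hx a).trans ?_
  simp only [pMean, if_true]
  refine Real.le_sqrt_of_sq_le ?_
  have hle : ∀ i, ((step p)^[i] (K, L)).1.supp a * ((step p)^[i] (K, L)).2.supp a ≤
      K.supp a * L.supp a := by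
    intro i
    induction i with
    | zero => exact le_rfl
    | succ i ih =>
      rw [Function.iterate_succ_apply']
      exact (supp_step_mul_le p _ _ a).trans ih
  rw [sq]
  exact le_of_tendsto' ((tendsto_supp (tendsto_iterate_step p K L).1 a).mul
    (tendsto_supp (tendsto_iterate_step p K L).2 a)) hle

theorem lowerMean_zero_subset_geomMean (p : ℝ) (K L : OriginBody n) :
    (lowerMean 0 K L).pts ⊆ (geomMean p K L).pts := by
  have h := within_one_iff.2 (geomMean_subset_upperMean_zero p K.polar L.polar)
  rw [← polar_geomMean] at h
  have h2 := h.polar one_pos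
  rw [polar_polar, polar_upperMean, polar_polar, polar_polar, neg_zero] at h2
  exact within_one_iff.1 h2

end Dilates

end OriginBody

/-! ### A constancy criterion on an interval -/

/-- If the increments of `f` are bounded by `C Δk Δs`, with `k` any real function, then the sum of
the increments over a partition of mesh `1 / N` is at most `C (k 1 - k 0) / N`. -/
theorem eq_of_abs_sub_le_mul {f k : ℝ → ℝ} {C : ℝ}
    (h : ∀ s ∈ Icc (0 : ℝ) 1, ∀ s' ∈ Icc (0 : ℝ) 1, s ≤ s' →
      |f s' - f s| ≤ C * ((k s' - k s) * (s' - s))) : f 1 = f 0 := by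
  have key : ∀ N : ℕ, |f 1 - f 0| ≤ C * (k 1 - k 0) * (1 / ((N : ℝ) + 1)) := by
    intro N
    set M : ℕ := N + 1 with hM
    have hMr : (N : ℝ) + 1 = M := by rw [hM]; push_cast; ring
    have hM0 : (0 : ℝ) < M := by rw [← hMr]; positivity
    have hmem : ∀ i, i ≤ M → (i : ℝ) / M ∈ Icc (0 : ℝ) 1 := fun i hi =>
      ⟨by positivity, by rw [div_le_one hM0]; exact_mod_cast hi⟩
    have e1 : f 1 - f 0 = ∑ i ∈ Finset.range M, (f ((i + 1 : ℕ) / M) - f ((i : ℕ) / M)) := by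
      rw [Finset.sum_range_sub (fun i : ℕ => f ((i : ℝ) / M))]
      simp [hM0.ne']
    have e2 : k 1 - k 0 = ∑ i ∈ Finset.range M, (k ((i + 1 : ℕ) / M) - k ((i : ℕ) / M)) := by
      rw [Finset.sum_range_sub (fun i : ℕ => k ((i : ℝ) / M))]
      simp [hM0.ne']
    rw [hMr, e1, e2, Finset.mul_sum, Finset.sum_mul]
    refine (Finset.abs_sum_le_sum_abs _ _).trans (Finset.sum_le_sum fun i hi => ?_)
    have hi' : i < M := Finset.mem_range.1 hi
    have hstep : ((i + 1 : ℕ) : ℝ) / M - (i : ℝ) / M = 1 / M := by push_cast; ring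
    refine (h _ (hmem i hi'.le) _ (hmem (i + 1) hi') ?_).trans (le_of_eq ?_)
    · have : (0 : ℝ) < 1 / M := by positivity
      linarith
    · rw [hstep]; ring
  have hlim : Tendsto (fun N : ℕ => C * (k 1 - k 0) * (1 / ((N : ℝ) + 1))) atTop (𝓝 0) := by
    simpa using tendsto_one_div_add_atTop_nhds_zero_nat.const_mul (C * (k 1 - k 0))
  have := ge_of_tendsto' hlim key
  exact sub_eq_zero.1 (abs_eq_zero.1 (le_antisymm this (abs_nonneg _)))

/-- If the functions `v / u` and `v u` have, at every point `s`, subgradients with the common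
logarithmic slope `k s / v s`, then `u` is constant. -/
theorem eq_of_common_log_slope {v u k : ℝ → ℝ} {m M : ℝ} (hm : 0 < m)
    (hv : ∀ s ∈ Icc (0 : ℝ) 1, m ≤ v s) (hu : ∀ s ∈ Icc (0 : ℝ) 1, 0 < u s)
    (huM : ∀ s ∈ Icc (0 : ℝ) 1, u s ≤ M)
    (h1 : ∀ s ∈ Icc (0 : ℝ) 1, ∀ s' ∈ Icc (0 : ℝ) 1,
      v s + k s * (s' - s) ≤ u s * (v s' / u s'))
    (h2 : ∀ s ∈ Icc (0 : ℝ) 1, ∀ s' ∈ Icc (0 : ℝ) 1,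
      v s + k s * (s' - s) ≤ (u s)⁻¹ * (v s' * u s')) : u 1 = u 0 := by
  -- adding the inequalities at `s` and `s'` gives `(v + v') (1 - b / c) ≤ Δk Δs`
  -- where `b ≤ c` are the two values of `u`
  have aux : ∀ a a' b c D : ℝ, m ≤ a → m ≤ a' → 0 < b → b ≤ c → c ≤ M →
      (a + a') * (1 - b / c) ≤ D → c - b ≤ M / (2 * m) * D := by
    intro a a' b c D ha ha' hb hbc hcM hD
    have hc : 0 < c := hb.trans_le hbc
    have h3 : 0 ≤ 1 - b / c := sub_nonneg.2 ((div_le_one hc).2 hbc)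
    have h4 : 2 * m * (1 - b / c) ≤ D :=
      (mul_le_mul_of_nonneg_right (by linarith) h3).trans hD
    calc c - b = c * (1 - b / c) := by field_simp
      _ ≤ M * (1 - b / c) := by gcongr
      _ = M / (2 * m) * (2 * m * (1 - b / c)) := by field_simp
      _ ≤ M / (2 * m) * D := by
        have : 0 < M := hc.trans_le hcM
        gcongr
  refine eq_of_abs_sub_le_mul (f := u) (k := k) (C := M / (2 * m)) fun s hs s' hs' _ => ?_
  have p0 := hu s hs
  have p1 := hu s' hs'
  rcases le_total (u s) (u s') with hle | hle
  · rw [abs_of_nonneg (sub_nonneg.2 hle)]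
    refine aux (v s) (v s') _ _ _ (hv s hs) (hv s' hs') p0 hle (huM s' hs') ?_
    have q1 := h1 s hs s' hs'
    have q2 := h2 s' hs' s hs
    have e1 : u s * (v s' / u s') = v s' * (u s / u s') := by ring
    have e2 : (u s')⁻¹ * (v s * u s) = v s * (u s / u s') := by ring
    rw [e1] at q1
    rw [e2] at q2
    linarith
  · rw [abs_of_nonpos (sub_nonpos.2 hle), neg_sub]
    refine aux (v s) (v s') _ _ _ (hv s hs) (hv s' hs') p1 hle (huM s hs) ?_
    have q1 := h1 s' hs' s hs
    have q2 := h2 s hs s' hs'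
    have e1 : u s' * (v s / u s) = v s * (u s' / u s) := by ring
    have e2 : (u s)⁻¹ * (v s' * u s') = v s' * (u s' / u s) := by ring
    rw [e1] at q1
    rw [e2] at q2
    linarith

/-! ### Equality of the lower and the upper `0`-mean -/

/-- If a linear functional bounded by `1` on `S` takes the value `1` at a point of the convex hull,
then this point lies in the convex hull of the contact points. -/
theorem mem_convexHull_contact {n : ℕ} {S : Set (Euc n)} {a x : Euc n} (hx : x ∈ convexHull ℝ S)
    (hS : ∀ y ∈ S, inner ℝ a y ≤ 1) (hax : inner ℝ a x = 1) :
    x ∈ convexHull ℝ {y ∈ S | inner ℝ a y = 1} := by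
  obtain ⟨ι, _, z, w, hz, -, hw, hw1, rfl⟩ := eq_pos_convex_span_of_mem_convexHull hx
  have hzS : ∀ i, z i ∈ S := fun i => hz ⟨i, rfl⟩
  have hsum : ∑ i, w i * (1 - inner ℝ a (z i)) = 0 := by
    simp only [mul_sub, mul_one, Finset.sum_sub_distrib, hw1]
    rw [inner_sum] at hax
    simp only [real_inner_smul_right] at hax
    rw [hax, sub_self]
  have h0 := (Finset.sum_eq_zero_iff_of_nonneg fun i _ =>
    mul_nonneg (hw i).le (sub_nonneg.2 (hS _ (hzS i)))).1 hsum
  have h1 : ∀ i, inner ℝ a (z i) = 1 := fun i => by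
    have := (mul_eq_zero.1 (h0 i (Finset.mem_univ i))).resolve_left (hw i).ne'
    linarith
  exact (convex_convexHull ℝ _).sum_mem (fun i _ => (hw i).le) hw1
    fun i _ => subset_convexHull ℝ _ ⟨hzS i, h1 i⟩

namespace OriginBody

variable {n : ℕ}

theorem zero_notMem_segment_of_linearIndependent {x y : Euc n}
    (h : LinearIndependent ℝ ![x, y]) : (0 : Euc n) ∉ segment ℝ x y := by
  rintro ⟨a, b, _, _, hab, h0⟩
  obtain ⟨rfl, rfl⟩ := LinearIndependent.pair_iff.1 h a b h0
  simp at hab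

theorem exists_inner_eq_supp (K : OriginBody n) (a : Euc n) :
    ∃ x ∈ K.pts, inner ℝ a x = K.supp a := by
  obtain ⟨x, hx, h⟩ := K.1.isCompact.exists_isMaxOn K.1.nonempty
    (f := fun x => inner ℝ a x) (by fun_prop)
  exact ⟨x, hx, le_antisymm (inner_le_supp hx a) (supp_le fun y hy => h hy)⟩

variable [NeZero n] {K L : OriginBody n}

/-- The generators `x / √(‖x‖_K ‖x‖_L)` of the lower `0`-mean are exactly the points at which the
product of the two gauges is `1`. -/
theorem lowerMean_zero_pts (K L : OriginBody n) :
    (lowerMean 0 K L).pts = convexHull ℝ {y | K.gau y * L.gau y = 1} := by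
  apply Subset.antisymm
  · refine convexHull_mono ?_
    rintro _ ⟨x, hx, rfl⟩
    have hx1 := mem_sphere_zero_iff_norm.1 hx
    have h1 := K.gauge_pos_of_norm_eq_one hx1
    have h2 := L.gauge_pos_of_norm_eq_one hx1
    simp only [pMean, neg_zero, if_true, mem_ofPred_eq]
    rw [gau_smul _ (by positivity), gau_smul _ (by positivity), mul_mul_mul_comm, ← mul_inv,
      Real.mul_self_sqrt (by positivity), inv_mul_cancel₀ (by positivity)]
  · refine convexHull_min (fun y hy => ?_) (lowerMean 0 K L).1.convex
    rw [← gau_le_one_iff]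
    refine (gau_lowerMean_le 0 K L y).trans ?_
    simp only [pMean, neg_zero, if_true]
    rw [show gauge K.pts y * gauge L.pts y = 1 from hy, Real.sqrt_one]

/-- If the lower and the upper `0`-mean agree, then every point `r ≠ 0` has a contact functional
`a` for the common mean `G` whose half-space also supports both `K` and `L` in the direction
of `r`. -/
theorem exists_common_contact (h : lowerMean 0 K L = upperMean 0 K L) {r : Euc n} (hr : r ≠ 0) :
    ∃ a, inner ℝ a r = (lowerMean 0 K L).gau r ∧ K.supp a * L.supp a = 1 ∧
      K.gau r * K.supp a = (lowerMean 0 K L).gau r ∧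
      L.gau r * L.supp a = (lowerMean 0 K L).gau r := by
  set G := lowerMean 0 K L with hG
  have hg := G.gau_pos hr
  set x := (G.gau r)⁻¹ • r with hx
  have hxG : x ∈ G.pts := G.gau_inv_smul_mem hr
  have hrx : r = G.gau r • x := by rw [hx, smul_inv_smul₀ hg.ne']
  have hx1 : G.gau x = 1 := by
    rw [hx, gau_smul _ (by positivity), inv_mul_cancel₀ hg.ne']
  have hGp : G.polar.pts = convexHull ℝ {b | K.polar.gau b * L.polar.gau b = 1} := by
    rw [h, polar_upperMean, neg_zero, lowerMean_zero_pts]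
  have hGc : G.pts = convexHull ℝ {y | K.gau y * L.gau y = 1} := lowerMean_zero_pts K L
  -- a contact functional which is one of the generators of `G°`
  obtain ⟨a₀, ha₀, ha₀x⟩ := G.polar.exists_inner_eq_supp x
  rw [supp_polar, hx1] at ha₀x
  rw [hGp] at ha₀
  have hne := mem_convexHull_contact ha₀ (a := x) (fun b hb => by
    have hbG : b ∈ G.polar.pts := by rw [hGp]; exact subset_convexHull ℝ _ hb
    rw [real_inner_comm]
    exact hbG x hxG) ha₀x
  obtain ⟨a, ha, hax⟩ := convexHull_nonempty_iff.1 ⟨_, hne⟩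
  have haG : a ∈ G.polar.pts := by rw [hGp]; exact subset_convexHull ℝ _ ha
  simp only [mem_ofPred_eq, gau_polar] at ha
  rw [real_inner_comm] at hax
  have ha0 : a ≠ 0 := by rintro rfl; simp at hax
  have hKa := K.supp_pos ha0
  have hLa := L.supp_pos ha0
  -- at the generators `y` of `G` in contact with `a` both support inequalities are equalities
  have hmem : x ∈ {y | K.gau y ≤ (K.supp a)⁻¹} ∩ {y | L.gau y ≤ (L.supp a)⁻¹} := by
    have h1 := mem_convexHull_contact (hGc ▸ hxG) (a := a) (fun y hy =>
      haG y (by rw [hGc]; exact subset_convexHull ℝ _ hy)) hax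
    refine convexHull_min ?_ ?_ h1
    · rintro y ⟨hy, hay⟩
      have k1 := K.inner_le_supp_mul_gau a y
      have k2 := L.inner_le_supp_mul_gau a y
      rw [hay] at k1 k2
      have hprod : (K.supp a * K.gau y) * (L.supp a * L.gau y) = 1 := by
        rw [mul_mul_mul_comm, ha, one_mul]; exact hy
      constructor
      · simp only [mem_ofPred_eq]
        rw [← one_div, le_div_iff₀ hKa, mul_comm]
        nlinarith
      · simp only [mem_ofPred_eq]
        rw [← one_div, le_div_iff₀ hLa, mul_comm]
        nlinarith
    · exact (K.1.convex.setOfPred_gauge_le K.zero_mem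
        (absorbent_nhds_zero K.pts_mem_nhds) _).inter
        (L.1.convex.setOfPred_gauge_le L.zero_mem (absorbent_nhds_zero L.pts_mem_nhds) _)
  have eK : K.gau x * K.supp a = 1 := by
    refine le_antisymm ?_ ?_
    · have := hmem.1
      simp only [mem_ofPred_eq] at this
      rwa [← one_div, le_div_iff₀ hKa] at this
    · have := K.inner_le_supp_mul_gau a x
      rwa [hax, mul_comm] at this
  have eL : L.gau x * L.supp a = 1 := by
    refine le_antisymm ?_ ?_
    · have := hmem.2
      simp only [mem_ofPred_eq] at this
      rwa [← one_div, le_div_iff₀ hLa] at this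
    · have := L.inner_le_supp_mul_gau a x
      rwa [hax, mul_comm] at this
  have sK : K.gau r = G.gau r * K.gau x := by
    conv_lhs => rw [hrx, gau_smul _ hg.le]
  have sL : L.gau r = G.gau r * L.gau x := by
    conv_lhs => rw [hrx, gau_smul _ hg.le]
  refine ⟨a, ?_, ha, ?_, ?_⟩
  · conv_lhs => rw [hrx, real_inner_smul_right, hax, mul_one]
  · rw [sK, mul_assoc, eK, mul_one]
  · rw [sL, mul_assoc, eL, mul_one]

/-- Along a segment that avoids the origin, the contact functionals give common logarithmic
subgradients of the gauges of `K` and `L`, so the ratio of the gauges is constant. -/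
theorem gau_ratio_eq_of_segment (h : lowerMean 0 K L = upperMean 0 K L) {x y : Euc n}
    (hxy : (0 : Euc n) ∉ segment ℝ x y) :
    L.gau y / (lowerMean 0 K L).gau y = L.gau x / (lowerMean 0 K L).gau x := by
  set G := lowerMean 0 K L with hG
  set r : ℝ → Euc n := fun s => x + s • (y - x) with hr
  have hr0 : ∀ s ∈ Icc (0 : ℝ) 1, r s ≠ 0 := fun s hs h0 =>
    hxy (by rw [segment_eq_image']; exact ⟨s, hs, h0⟩)
  have hrc : Continuous r := by fun_prop
  choose! a ha1 ha2 haK haL using fun (z : Euc n) (hz : z ≠ 0) => exists_common_contact h hz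
  have hGc : Continuous fun s => G.gau (r s) :=
    (continuous_gauge G.1.convex G.pts_mem_nhds).comp hrc
  have hLc : Continuous fun s => L.gau (r s) :=
    (continuous_gauge L.1.convex L.pts_mem_nhds).comp hrc
  have hGp : ∀ s ∈ Icc (0 : ℝ) 1, 0 < G.gau (r s) := fun s hs => G.gau_pos (hr0 s hs)
  have hne : (Icc (0 : ℝ) 1).Nonempty := ⟨0, by simp⟩
  obtain ⟨s₀, hs₀, hmin⟩ := isCompact_Icc.exists_isMinOn hne hGc.continuousOn
  obtain ⟨s₁, hs₁, hmax⟩ := isCompact_Icc.exists_isMaxOn hne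
    (hLc.continuousOn.div hGc.continuousOn fun s hs => (hGp s hs).ne')
  -- on the segment the support function of `K` at the contact functional is the ratio of gauges
  have hsK : ∀ s ∈ Icc (0 : ℝ) 1, K.supp (a (r s)) = L.gau (r s) / G.gau (r s) := fun s hs => by
    have e1 := ha2 _ (hr0 s hs)
    have e2 := haL _ (hr0 s hs)
    rw [eq_div_iff (hGp s hs).ne', ← e2, ← mul_assoc, mul_comm (K.supp _), mul_assoc, e1, mul_one]
  have hsL : ∀ s ∈ Icc (0 : ℝ) 1, L.supp (a (r s)) = (L.gau (r s) / G.gau (r s))⁻¹ := fun s hs =>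
    by rw [← hsK s hs]; exact eq_inv_of_mul_eq_one_right (ha2 _ (hr0 s hs))
  have hu : ∀ s ∈ Icc (0 : ℝ) 1, 0 < L.gau (r s) / G.gau (r s) := fun s hs =>
    div_pos (L.gau_pos (hr0 s hs)) (hGp s hs)
  have hgK : ∀ s ∈ Icc (0 : ℝ) 1, K.gau (r s) = G.gau (r s) / (L.gau (r s) / G.gau (r s)) :=
    fun s hs => by
      rw [eq_div_iff (hu s hs).ne', ← hsK s hs]
      exact haK _ (hr0 s hs)
  have hgL : ∀ s ∈ Icc (0 : ℝ) 1, L.gau (r s) = G.gau (r s) * (L.gau (r s) / G.gau (r s)) :=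
    fun s hs => (mul_div_cancel₀ _ (hGp s hs).ne').symm
  have hlin : ∀ s ∈ Icc (0 : ℝ) 1, ∀ s', inner ℝ (a (r s)) (r s') =
      G.gau (r s) + inner ℝ (a (r s)) (y - x) * (s' - s) := fun s hs s' => by
    rw [← ha1 _ (hr0 s hs)]
    simp only [hr, inner_add_right, real_inner_smul_right]
    ring
  have := eq_of_common_log_slope (v := fun s => G.gau (r s))
    (u := fun s => L.gau (r s) / G.gau (r s)) (k := fun s => inner ℝ (a (r s)) (y - x))
    (hGp s₀ hs₀) (fun s hs => hmin hs) hu (fun s hs => hmax hs)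
    (fun s hs s' hs' => by
      rw [← hlin s hs, ← hsK s hs]
      rw [← hgK s' hs']
      exact inner_le_supp_mul_gau _ _ _)
    (fun s hs s' hs' => by
      rw [← hlin s hs, ← hsL s hs]
      rw [← hgL s' hs']
      exact inner_le_supp_mul_gau _ _ _)
  simpa [hr] using this

/-- In dimension at least two the lower and the upper `0`-mean agree only for dilatates. -/
theorem isDilatate_of_lowerMean_eq_upperMean (hn : n ≠ 1)
    (h : lowerMean 0 K L = upperMean 0 K L) : IsDilatate K L := by
  have hn2 : 1 < n := by have := NeZero.ne n; omega
  set G := lowerMean 0 K L with hG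
  have : Nontrivial (Fin n) := Fin.nontrivial_iff_two_le.2 hn2
  obtain ⟨x, hx⟩ := exists_ne (0 : Euc n)
  obtain ⟨z, hz⟩ := exists_linearIndependent_pair_of_one_lt_finrank (R := ℝ) (M := Euc n)
    (by simpa using hn2) hx
  have hconst : ∀ y : Euc n, y ≠ 0 → L.gau y / G.gau y = L.gau x / G.gau x := by
    intro y hy
    by_cases hxy : (0 : Euc n) ∈ segment ℝ x y
    · -- then `y` is a negative multiple of `x`, and the detour through `z` avoids the origin
      rw [← gau_ratio_eq_of_segment h (zero_notMem_segment_of_linearIndependent hz)]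
      apply gau_ratio_eq_of_segment h
      obtain ⟨a, b, _, _, hab, h0⟩ := hxy
      rintro ⟨a', b', _, _, hab', h0'⟩
      have hb : b ≠ 0 := by
        rintro rfl
        simp_all
      have ha : a ≠ 0 := by
        rintro rfl
        simp_all
      have h1 : (-(b' * a)) • x + (b * a') • z = 0 := by
        calc (-(b' * a)) • x + (b * a') • z =
            b • (a' • z + b' • y) - b' • (a • x + b • y) := by module
          _ = 0 := by rw [h0, h0', smul_zero, smul_zero, sub_zero]
      obtain ⟨h2, h3⟩ := LinearIndependent.pair_iff.1 hz _ _ h1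
      have h4 : a' = 0 := (mul_eq_zero.1 h3).resolve_left hb
      have h5 : b' = 0 := (mul_eq_zero.1 (neg_eq_zero.1 h2)).resolve_right ha
      rw [h4, h5] at hab'
      simp at hab'
    · exact gau_ratio_eq_of_segment h hxy
  set c := L.gau x / G.gau x with hc
  have hc0 : 0 < c := div_pos (L.gau_pos hx) (G.gau_pos hx)
  rw [← isDilatate_polar_iff, isDilatate_iff]
  refine ⟨(c ^ 2)⁻¹, by positivity, ext_supp fun y => ?_⟩
  rw [supp_scale, supp_polar, supp_polar]
  by_cases hy : y = 0
  · simp [hy]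
  obtain ⟨a, -, ha, hK, hL⟩ := exists_common_contact h hy
  rw [← hG] at hK hL
  have hg := G.gau_pos hy
  have e := hconst y hy
  rw [div_eq_iff hg.ne'] at e
  have hLs : c * L.supp a = 1 := by
    have h1 : G.gau y * (c * L.supp a) = G.gau y * 1 := by
      rw [e] at hL
      linear_combination hL
    exact mul_left_cancel₀ hg.ne' h1
  have hLa : L.supp a = c⁻¹ := eq_inv_of_mul_eq_one_right hLs
  rw [hLa, mul_inv_eq_one₀ hc0.ne'] at ha
  rw [ha] at hK
  rw [e, ← hK]
  field_simp

/-- If `G_0(K, L)` is the upper mean `U`, then `U = G_0(U, W)` is contained in the upper mean of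
`U` and the lower mean `W`; hence `h_U ≤ √(h_U h_W)`, which gives `U = W`. -/
theorem lowerMean_eq_upperMean_of_geomMean_eq (h : geomMean 0 K L = upperMean 0 K L) :
    lowerMean 0 K L = upperMean 0 K L := by
  have h1 : Within 1 (upperMean 0 K L)
      (upperMean 0 (upperMean 0 K L) (lowerMean 0 K L)) := by
    rw [within_one_iff]
    conv_lhs => rw [← h, ← geomMean_step, neg_zero]
    exact geomMean_subset_upperMean_zero 0 _ _
  refine ext_supp fun a => le_antisymm ?_ ?_
  · simpa using lowerMean_within_upperMean 0 K L a
  · by_cases ha : a = 0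
    · simp [ha, supp_zero]
    have hU := (upperMean 0 K L).supp_pos ha
    have h2 := h1 a
    rw [one_mul] at h2
    replace h2 := h2.trans (supp_upperMean_le 0 _ _ a)
    simp only [pMean, if_true] at h2
    have h3 := (Real.le_sqrt' hU).1 h2
    rw [sq] at h3
    exact le_of_mul_le_mul_left h3 hU

/-- On the line the point of `K` furthest in the direction of `x` is `x / ‖x‖_K`. -/
theorem supp_mul_gau_of_dim_one (K : OriginBody 1) {x : Euc 1} (hx : x ≠ 0) :
    K.supp x * K.gau x ≤ inner ℝ x x := by
  have hg := K.gau_pos hx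
  have hxx : 0 < inner ℝ x x := by
    rw [real_inner_self_eq_norm_sq]
    have := norm_pos_iff.2 hx
    positivity
  rw [← le_div_iff₀ hg]
  refine supp_le fun y hy => ?_
  obtain ⟨c, rfl⟩ : ∃ c : ℝ, c • x = y := by
    have h0 : x 0 ≠ 0 := fun h0 => hx (by ext i; rw [Subsingleton.elim i 0, h0]; rfl)
    refine ⟨y 0 / x 0, ?_⟩
    ext i
    rw [Subsingleton.elim i 0]
    simp [h0]
  rw [real_inner_smul_right, mul_comm, div_eq_mul_inv]
  refine mul_le_mul_of_nonneg_left ?_ hxx.le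
  rcases le_or_gt c 0 with hc | hc
  · exact hc.trans (by positivity)
  · rw [← gau_le_one_iff, gau_smul _ hc.le] at hy
    rwa [← one_div, le_div_iff₀ hg]

theorem lowerMean_eq_upperMean_of_dim_one (hn : n = 1) :
    lowerMean 0 K L = upperMean 0 K L := by
  subst hn
  refine ext_pts (Subset.antisymm (within_one_iff.1 (lowerMean_within_upperMean 0 K L)) ?_)
  intro x hx
  by_cases hx0 : x = 0
  · rw [hx0]; exact zero_mem _
  rw [← gau_le_one_iff]
  refine (gau_lowerMean_le 0 K L x).trans ?_
  have h1 := mem_upperMean_iff.1 hx x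
  simp only [pMean, neg_zero, if_true] at h1 ⊢
  have hK := K.gau_pos hx0
  have hL := L.gau_pos hx0
  have hxx : 0 < inner ℝ x x := by
    rw [real_inner_self_eq_norm_sq]
    have := norm_pos_iff.2 hx0
    positivity
  have h2 := (Real.le_sqrt' hxx).1 h1
  have h3 : (K.supp x * K.gau x) * (L.supp x * L.gau x) ≤ inner ℝ x x * inner ℝ x x :=
    mul_le_mul (supp_mul_gau_of_dim_one K hx0) (supp_mul_gau_of_dim_one L hx0)
      (mul_nonneg (supp_nonneg _ _) hL.le) hxx.le
  refine Real.sqrt_le_iff.2 ⟨zero_le_one, ?_⟩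
  rw [one_pow]
  have h4 : (inner ℝ x x) ^ 2 * (K.gau x * L.gau x) ≤ (inner ℝ x x) ^ 2 * 1 := by
    calc (inner ℝ x x) ^ 2 * (K.gau x * L.gau x)
        ≤ (K.supp x * L.supp x) * (K.gau x * L.gau x) := by gcongr
      _ = (K.supp x * K.gau x) * (L.supp x * L.gau x) := by ring
      _ ≤ _ := h3
      _ = _ := by ring
  exact le_of_mul_le_mul_left h4 (by positivity)

theorem lowerMean_eq_upperMean_iff :
    lowerMean 0 K L = upperMean 0 K L ↔ n = 1 ∨ IsDilatate K L := by
  refine ⟨fun h => or_iff_not_imp_left.2 fun hn => isDilatate_of_lowerMean_eq_upperMean hn h, ?_⟩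
  rintro (hn | h)
  · exact lowerMean_eq_upperMean_of_dim_one hn
  · obtain ⟨c, hc, rfl⟩ := isDilatate_iff.1 h
    have hpos : 0 < √(c * 1) := by positivity
    have h1 := upperMean_zero_scale hc one_pos hpos L L
    have h2 := lowerMean_zero_scale hc one_pos hpos L L
    rw [scale_one, upperMean_self] at h1
    rw [scale_one, lowerMean_self] at h2
    rw [h1, h2]

theorem geomMean_eq_upperMean_iff :
    geomMean 0 K L = upperMean 0 K L ↔ n = 1 ∨ IsDilatate K L := by
  rw [← lowerMean_eq_upperMean_iff]
  refine ⟨lowerMean_eq_upperMean_of_geomMean_eq, fun h => ext_pts (Subset.antisymm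
    (geomMean_subset_upperMean_zero 0 K L) ?_)⟩
  rw [← h]
  exact lowerMean_zero_subset_geomMean 0 K L

theorem lowerMean_eq_geomMean_iff :
    lowerMean 0 K L = geomMean 0 K L ↔ n = 1 ∨ IsDilatate K L := by
  rw [← isDilatate_polar_iff, ← geomMean_eq_upperMean_iff, ← polar_injective.eq_iff,
    polar_lowerMean, polar_geomMean, neg_zero]
  exact eq_comm

end OriginBody

end

theorem mainTheorem2 (n : ℕ) [NeZero n] :
    (∀ p : ℝ,
      -- both sequences of iterated means converge to `G_p(K, L)`
      (∀ K L : OriginBody n,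
        Tendsto (fun i => (OriginBody.iterMean p K L i).1) atTop
            (𝓝 (OriginBody.geomMean p K L)) ∧
          Tendsto (fun i => (OriginBody.iterMean p K L i).2) atTop
            (𝓝 (OriginBody.geomMean p K L))) ∧
      -- `G_p(K, K) = K`
      (∀ K : OriginBody n, OriginBody.geomMean p K K = K) ∧
      -- symmetry in the arguments
      (∀ K L : OriginBody n, OriginBody.geomMean p K L = OriginBody.geomMean p L K) ∧
      -- monotonicity in both arguments
      (∀ K K' L L' : OriginBody n, K.pts ⊆ K'.pts → L.pts ⊆ L'.pts →
        (OriginBody.geomMean p K L).pts ⊆ (OriginBody.geomMean p K' L').pts) ∧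
      -- joint continuity with respect to the Hausdorff metric
      Continuous (fun q : OriginBody n × OriginBody n => OriginBody.geomMean p q.1 q.2) ∧
      -- linear invariance
      (∀ (A : Matrix (Fin n) (Fin n) ℝ) (hA : IsUnit A) (K L : OriginBody n),
        OriginBody.geomMean p (OriginBody.linImage A hA K) (OriginBody.linImage A hA L) =
          OriginBody.linImage A hA (OriginBody.geomMean p K L)) ∧
      -- `G_p(P K, K°) = P^{1/2} B`, and in particular `G_p(K, K°) = B`
      (∀ (P : Matrix (Fin n) (Fin n) ℝ) (hP : P.PosDef) (K : OriginBody n),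
        (OriginBody.geomMean p (OriginBody.linImage P hP.isUnit K) K.polar).pts =
          Matrix.toEuclideanLin (CFC.sqrt P) '' Metric.closedBall (0 : Euc n) 1) ∧
      (∀ K : OriginBody n, OriginBody.geomMean p K K.polar = OriginBody.unitBall n) ∧
      -- commutation with polarity
      (∀ K L : OriginBody n,
        (OriginBody.geomMean p K L).polar = OriginBody.geomMean p K.polar L.polar) ∧
      -- position between the lower and the upper `0`-mean
      (∀ K L : OriginBody n,
        (OriginBody.lowerMean 0 K L).pts ⊆ (OriginBody.geomMean p K L).pts ∧
          (OriginBody.geomMean p K L).pts ⊆ (OriginBody.upperMean 0 K L).pts)) ∧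
    -- equality cases for `p = 0`
    (∀ K L : OriginBody n,
      (OriginBody.lowerMean 0 K L = OriginBody.geomMean 0 K L ↔
          n = 1 ∨ OriginBody.IsDilatate K L) ∧
        (OriginBody.geomMean 0 K L = OriginBody.upperMean 0 K L ↔
          n = 1 ∨ OriginBody.IsDilatate K L)) ∧
    -- the scaling property for `p = 0`
    (∀ (α β : ℝ) (hα : 0 < α) (hβ : 0 < β) (K L : OriginBody n),
      OriginBody.geomMean 0 (OriginBody.scale α hα K) (OriginBody.scale β hβ L) =
        OriginBody.scale (√(α * β)) (Real.sqrt_pos.2 (mul_pos hα hβ))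
          (OriginBody.geomMean 0 K L)) := by
  refine ⟨fun p => ⟨OriginBody.tendsto_iterMean p, OriginBody.geomMean_self p,
    OriginBody.geomMean_comm p, fun _ _ _ _ => OriginBody.geomMean_mono p,
    OriginBody.continuous_geomMean p, fun _ hA K L => OriginBody.geomMean_linImage p hA K L,
    fun _ hP K => OriginBody.geomMean_posDef p hP K, OriginBody.geomMean_polar_self p,
    OriginBody.polar_geomMean p, fun K L => ⟨OriginBody.lowerMean_zero_subset_geomMean p K L,
      OriginBody.geomMean_subset_upperMean_zero p K L⟩⟩,
    fun _ _ => ⟨OriginBody.lowerMean_eq_geomMean_iff, OriginBody.geomMean_eq_upperMean_iff⟩,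
    fun _ _ hα hβ K L => OriginBody.geomMean_zero_scale hα hβ _ K L⟩
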